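/- Let $E/\mathbb{Q}$ be an elliptic curve, given by a minimal Weierstrass equation $y^2+\alpha_1xy+\alpha_3y=x^3+\alpha_2x^2+\alpha_4x+\alpha_6$ over $\mathbb{Z}$. Let $L(E,s)=\sum_n a_n n^{-s}=\prod_p (1-a_pp^{-s}+1_E(p)p^{1-2s})^{-1}$ be its $L$-series, where $a_p=p+1-\#E(\mathbb{Z}/p\mathbb{Z})$ and $1_E(p)$ is $1$ if $E$ has good reduction at $p$ and $0$ otherwise. Let $N$ be a positive integer. * $N$ is an *elliptic Korselt number of Type I* for $E$ if $N$ has at least two distinct prime factors and, for every prime $p\mid N$: $E$ has good reduction at $p$; $p+1-a_p$ divides $N+1-a_N$; and $\operatorname{ord}_p(a_N-1)\ge \operatorname{ord}_p(N)-\delta_p$, where $\delta_p=0$ if $a_p\equiv 1\pmod p$ and $\delta_p=1$ otherwise (with $\operatorname{ord}_p(0)=\infty$). * Suppose that $N+1-a_N$ is even. Then $N$ is an *Euler elliptic Carmichael number* for $E$ if $N$ has at least two distinct prime factors, $E$ has good reduction at every prime dividing $N$, and every point $P$ of the group $E(\mathbb{Z}/N\mathbb{Z})$ satisfies the following: if $P=2Q$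 for some $Q\in E(\mathbb{Z}/N\mathbb{Z})$, then $\frac{N+1-a_N}{2}P=\mathcal{O}$; otherwise $\frac{N+1-a_N}{2}P$ is either $\mathcal{O}$ or a point of the form $[x:y:1]$ with $2y+\alpha_1x+\alpha_3\equiv 0\pmod N$. **Proposition.** Let $N$ be an odd elliptic Korselt number of Type I for $E$ such that $N+1-a_N$ is even. Then $N$ is an Euler elliptic Carmichael number for $E$ if and only if, for every prime $p$ dividing $N$, (i) $p+1-a_p$ divides $\frac{N+1-a_N}{2}$, or (ii) $E(\mathbb{F}_p)$ has exactly three elements of order $2$. -/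

import Mathlib

namespace EllipticKorselt

/-! ### Minimal models over the integers and good reduction -/

/-- `W` is an integral Weierstrass equation of the elliptic curve `E` over `ℚ`: it has integer
coefficients and arises from `E` by an admissible change of variables over `ℚ`. -/
def IsIntegralModel (W : WeierstrassCurve ℤ) (E : WeierstrassCurve ℚ) : Prop :=
  ∃ C : WeierstrassCurve.VariableChange ℚ, C • E = W.map (Int.castRingHom ℚ)

/-- `W` is a (global) minimal Weierstrass equation of `E`: among all integral Weierstrass equations
of `E`, its discriminant has the least absolute value. -/
def IsMinimalModel (W : WeierstrassCurve ℤ) (E : WeierstrassCurve ℚ) : Prop :=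
  IsIntegralModel W E ∧ ∀ W' : WeierstrassCurve ℤ, IsIntegralModel W' E → |W.Δ| ≤ |W'.Δ|

theorem exists_isIntegralModel (E : WeierstrassCurve ℚ) :
    ∃ W : WeierstrassCurve ℤ, IsIntegralModel W E := by
  have key : ∃ d : ℤ, d ≠ 0 ∧ (∃ n : ℤ, (n : ℚ) = d * E.a₁) ∧ (∃ n : ℤ, (n : ℚ) = d * E.a₂) ∧
      (∃ n : ℤ, (n : ℚ) = d * E.a₃) ∧ (∃ n : ℤ, (n : ℚ) = d * E.a₄) ∧
      (∃ n : ℤ, (n : ℚ) = d * E.a₆) := by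
    have h (q : ℚ) : (q.den : ℚ) * q = (q.num : ℚ) := by
      rw [mul_comm]; exact Rat.mul_den_eq_num q
    refine ⟨E.a₁.den * E.a₂.den * E.a₃.den * E.a₄.den * E.a₆.den, by simp, ?_, ?_, ?_, ?_, ?_⟩
    · exact ⟨E.a₂.den * E.a₃.den * E.a₄.den * E.a₆.den * E.a₁.num, by
        push_cast; rw [← h E.a₁]; ring⟩
    · exact ⟨E.a₁.den * E.a₃.den * E.a₄.den * E.a₆.den * E.a₂.num, by
        push_cast; rw [← h E.a₂]; ring⟩
    · exact ⟨E.a₁.den * E.a₂.den * E.a₄.den * E.a₆.den * E.a₃.num, by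
        push_cast; rw [← h E.a₃]; ring⟩
    · exact ⟨E.a₁.den * E.a₂.den * E.a₃.den * E.a₆.den * E.a₄.num, by
        push_cast; rw [← h E.a₄]; ring⟩
    · exact ⟨E.a₁.den * E.a₂.den * E.a₃.den * E.a₄.den * E.a₆.num, by
        push_cast; rw [← h E.a₆]; ring⟩
  obtain ⟨d, hd, ⟨n₁, h₁⟩, ⟨n₂, h₂⟩, ⟨n₃, h₃⟩, ⟨n₄, h₄⟩, ⟨n₆, h₆⟩⟩ := key
  have hdQ : (d : ℚ) ≠ 0 := by exact_mod_cast hd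
  refine ⟨⟨n₁, d * n₂, d ^ 2 * n₃, d ^ 3 * n₄, d ^ 5 * n₆⟩, ⟨(Units.mk0 (d : ℚ) hdQ)⁻¹, 0, 0, 0⟩, ?_⟩
  ext <;> simp [WeierstrassCurve.variableChange_def, h₁, h₂, h₃, h₄, h₆] <;> ring

theorem exists_isMinimalModel (E : WeierstrassCurve ℚ) :
    ∃ W : WeierstrassCurve ℤ, IsMinimalModel W E := by
  classical
  have hex : ∃ n : ℕ, ∃ W : WeierstrassCurve ℤ, IsIntegralModel W E ∧ W.Δ.natAbs = n := by
    obtain ⟨W, hW⟩ := exists_isIntegralModel E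
    exact ⟨_, W, hW, rfl⟩
  obtain ⟨W, hW, hn⟩ := Nat.find_spec hex
  refine ⟨W, hW, fun W' hW' => ?_⟩
  have h : W.Δ.natAbs ≤ W'.Δ.natAbs := hn.trans_le (Nat.find_min' hex ⟨W', hW', rfl⟩)
  rw [Int.abs_eq_natAbs, Int.abs_eq_natAbs]
  exact_mod_cast h

/-- A minimal Weierstrass equation of `E` (unique up to an integral change of variables). -/
noncomputable def minimalModel (E : WeierstrassCurve ℚ) : WeierstrassCurve ℤ :=
  (exists_isMinimalModel E).choose

/-- The minimal Weierstrass equation of `E` with coefficients reduced modulo `n`. -/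
noncomputable def modCurve (E : WeierstrassCurve ℚ) (n : ℕ) : WeierstrassCurve (ZMod n) :=
  (minimalModel E).map (Int.castRingHom (ZMod n))

/-- `E` has good reduction at `p`: the minimal discriminant is not divisible by `p`. -/
def GoodReduction (E : WeierstrassCurve ℚ) (p : ℕ) : Prop :=
  ¬ (p : ℤ) ∣ (minimalModel E).Δ

/-! ### Points of a projective Weierstrass cubic over a ring -/

section Points

variable {R : Type*} [CommRing R]

/-- A triple of elements of `R` is primitive if it generates the unit ideal. -/
def IsPrimitive (v : Fin 3 → R) : Prop :=
  Ideal.span (Set.range v) = ⊤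

/-- The points `[x : y : z]` of the projective cubic `W` over `R`: primitive triples that satisfy the
homogeneous Weierstrass equation, up to multiplication by units of `R`. (For `R = ZMod n` with
`n ≠ 0`, and for `R` a field, these are all sections of the projective plane that lie on `W`.) -/
def Points (W : WeierstrassCurve R) : Type _ :=
  {P : WeierstrassCurve.Projective.PointClass R //
    ∃ v : Fin 3 → R, P = Quotient.mk _ v ∧ IsPrimitive v ∧ W.toProjective.Equation v}

variable {W : WeierstrassCurve R}

/-- The triple `v` is a system of homogeneous coordinates of the point `P`. -/
def Points.IsRep (P : Points W) (v : Fin 3 → R) : Prop :=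
  P.1 = Quotient.mk _ v

/-- The identity `𝒪 = [0 : 1 : 0]`. -/
instance : Zero (Points W) where
  zero := ⟨Quotient.mk _ ![0, 1, 0], ![0, 1, 0], rfl,
    (Ideal.eq_top_iff_one _).2 (Ideal.subset_span ⟨1, rfl⟩),
    WeierstrassCurve.Projective.equation_zero⟩

theorem isPrimitive_neg {v : Fin 3 → R} (hv : IsPrimitive v) :
    IsPrimitive (W.toProjective.neg v) := by
  unfold IsPrimitive at *
  rw [eq_top_iff, ← hv, Ideal.span_le]
  have h (i : Fin 3) : W.toProjective.neg v i ∈ Ideal.span (Set.range (W.toProjective.neg v)) :=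
    Ideal.subset_span ⟨i, rfl⟩
  have h0 : v 0 ∈ Ideal.span (Set.range (W.toProjective.neg v)) := h 0
  have h2 : v 2 ∈ Ideal.span (Set.range (W.toProjective.neg v)) := h 2
  have h1 : v 1 ∈ Ideal.span (Set.range (W.toProjective.neg v)) := by
    have e : v 1 = -(W.toProjective.neg v 1) - W.a₁ * v 0 - W.a₃ * v 2 := by
      rw [WeierstrassCurve.Projective.neg_Y, WeierstrassCurve.Projective.negY]; ring
    rw [e]
    exact sub_mem (sub_mem (neg_mem (h 1)) (Ideal.mul_mem_left _ _ h0)) (Ideal.mul_mem_left _ _ h2)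
  rintro _ ⟨i, rfl⟩
  fin_cases i
  · exact h0
  · exact h1
  · exact h2

theorem equation_neg {v : Fin 3 → R} (hv : W.toProjective.Equation v) :
    W.toProjective.Equation (W.toProjective.neg v) := by
  rw [WeierstrassCurve.Projective.equation_iff] at *
  rw [WeierstrassCurve.Projective.neg_X, WeierstrassCurve.Projective.neg_Y,
    WeierstrassCurve.Projective.neg_Z, WeierstrassCurve.Projective.negY]
  linear_combination hv

/-- The negation `[x : y : z] ↦ [x : -y - a₁x - a₃z : z]`. -/
instance : Neg (Points W) where
  neg P := ⟨W.toProjective.negMap P.1, by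
    obtain ⟨P, v, rfl, hv, hW⟩ := P
    exact ⟨W.toProjective.neg v, rfl, isPrimitive_neg hv, equation_neg hW⟩⟩

/-- The intersection of the cubic `W` with some line is exactly the three points `P`, `Q`, `T`,
counted with multiplicity.

The line is given by a parametrization `(s, t) ↦ s • A + t • B` that is a closed immersion (the
`2 × 2` minors of `A`, `B` generate the unit ideal). The point with parameters `(s, t) = (p₁, p₂)`
is the zero of the linear form `p₂ s - p₁ t`, so the condition is that the restriction of the
Weierstrass polynomial to the line is a unit times the product of the three linear forms. -/
def CutByLine (P Q T : Points W) : Prop :=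
  ∃ (A B : Fin 3 → R) (p₁ p₂ q₁ q₂ t₁ t₂ : R) (c : Rˣ),
    IsPrimitive (crossProduct A B) ∧
    P.IsRep (p₁ • A + p₂ • B) ∧ Q.IsRep (q₁ • A + q₂ • B) ∧ T.IsRep (t₁ • A + t₂ • B) ∧
    MvPolynomial.aeval
        (fun i => MvPolynomial.C (A i) * MvPolynomial.X 0 + MvPolynomial.C (B i) * MvPolynomial.X 1)
        W.toProjective.polynomial =
      (MvPolynomial.C (c : R) *
        ((MvPolynomial.C p₂ * MvPolynomial.X 0 - MvPolynomial.C p₁ * MvPolynomial.X 1) *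
          (MvPolynomial.C q₂ * MvPolynomial.X 0 - MvPolynomial.C q₁ * MvPolynomial.X 1) *
          (MvPolynomial.C t₂ * MvPolynomial.X 0 - MvPolynomial.C t₁ * MvPolynomial.X 1)) :
        MvPolynomial (Fin 2) R)

open Classical in
/-- The chord and tangent law: `P + Q = S` when `P`, `Q`, `-S` are the three intersection points of
`W` with a line. Over `ZMod n` with the discriminant prime to `n` (and over any field when the
discriminant is nonzero) there is exactly one such `S`, and this is the group law of the elliptic
curve; the value `𝒪` is only a default for the singular case. -/
noncomputable instance : Add (Points W) where
  add P Q := if h : ∃ S : Points W, CutByLine P Q (-S) then h.choose else 0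

/-- The multiple `m P` of a point, for an integer `m`: the iterated sum of `P`, or its negative. -/
noncomputable def mul (m : ℤ) (P : Points W) : Points W :=
  zsmulRec nsmulRec m P

/-- A 2-torsion point: either `𝒪` or a point `[x : y : 1]` with `2y + a₁x + a₃ = 0` in `R`. -/
def IsTwoTorsion (P : Points W) : Prop :=
  P = 0 ∨ ∃ x y : R, P.IsRep ![x, y, 1] ∧ 2 * y + W.a₁ * x + W.a₃ = 0

end Points

/-! ### The coefficients of the `L`-series -/

/-- `a_p = p + 1 - #E(ℤ/pℤ)`, whether or not `E` has good reduction at `p`. (At a prime of bad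
reduction the singular point is counted as well.) -/
noncomputable def traceAt (E : WeierstrassCurve ℚ) (p : ℕ) : ℤ :=
  (p : ℤ) + 1 - Nat.card (Points (modCurve E p))

open Classical in
/-- The coefficients `a_n` of the `L`-series `∑ a_n / n ^ s` of `E`, which is the Euler product of
the factors `1 / (1 - a_p T + 1_E(p) p T ^ 2)` with `T = p ^ (-s)`, where `1_E(p)` is `1` if `E` has
good reduction at `p` and `0` otherwise. -/
noncomputable def lCoeff (E : WeierstrassCurve ℚ) : ArithmeticFunction ℤ :=
  ArithmeticFunction.eulerProduct fun p : Nat.Primes =>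
    ArithmeticFunction.ofPowerSeries (p : ℕ)
      (PowerSeries.invOfUnit
        (1 - PowerSeries.C (traceAt E p) * PowerSeries.X +
          PowerSeries.C (if GoodReduction E p then (p : ℤ) else 0) * PowerSeries.X ^ 2) 1)

/-! ### Korselt numbers of Type I and Euler elliptic Carmichael numbers -/

open Classical in
/-- `N` is an elliptic Korselt number of Type I for `E`. -/
def IsKorseltTypeI (E : WeierstrassCurve ℚ) (N : ℕ) : Prop :=
  2 ≤ N.primeFactors.card ∧
  ∀ p : ℕ, p.Prime → p ∣ N →
    GoodReduction E p ∧
    (p : ℤ) + 1 - lCoeff E p ∣ (N : ℤ) + 1 - lCoeff E N ∧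
    emultiplicity (p : ℤ) (N : ℤ) ≤
      emultiplicity (p : ℤ) (lCoeff E N - 1) + if lCoeff E p ≡ 1 [ZMOD p] then 0 else 1

/-- `N` is an Euler elliptic pseudoprime for `(E, P)`, where `P ∈ E(ℤ/Nℤ)`. -/
def IsEulerPseudoprime (E : WeierstrassCurve ℚ) (N : ℕ) (P : Points (modCurve E N)) : Prop :=
  Even ((N : ℤ) + 1 - lCoeff E N) ∧
  2 ≤ N.primeFactors.card ∧
  (∀ p : ℕ, p.Prime → p ∣ N → GoodReduction E p) ∧
  ((∃ Q, P = Q + Q) → mul (((N : ℤ) + 1 - lCoeff E N) / 2) P = 0) ∧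
  ((¬ ∃ Q, P = Q + Q) → IsTwoTorsion (mul (((N : ℤ) + 1 - lCoeff E N) / 2) P))

/-- `N` is an Euler elliptic Carmichael number for `E`. -/
def IsEulerCarmichael (E : WeierstrassCurve ℚ) (N : ℕ) : Prop :=
  ∀ P : Points (modCurve E N), IsEulerPseudoprime E N P

end EllipticKorselt

namespace EllipticKorselt

open MvPolynomial

section Basic

variable {R S : Type*} [CommRing R] [CommRing S]

/-! ### Primitive triples -/

-- Put M = N + 1 - a_N. If p^e exactly divides N, then E(ℤ/p^e) maps onto E(𝔽_p) with kernel of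
-- order p^(e-1). The Korselt conditions give p^(e-1) * #E(𝔽_p) ∣ M (`prime_pow_mul_card_dvd`), so M
-- kills E(ℤ/N) = ∏ E(ℤ/p^e), and M/2 kills every double. Since N is odd the kernels have odd order,
-- so M/2 kills E(ℤ/p^e) as soon as it kills E(𝔽_p). Conversely, a point supported at a single prime
-- has (M/2)P = 𝒪 at another prime divisor, which excludes the form [x : y : 1]; hence an Euler
-- elliptic Carmichael number has M/2 killing every E(𝔽_p). This is
-- `isEulerCarmichael_iff_smul_eq_zero`.
--
-- What remains concerns H = E(𝔽_p), a finite abelian group with #H ∣ M and at most three elements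
-- of order 2, never exactly two. With three of them, #(2H) = #H/4 and M/2 always kills H. With at
-- most one, the 2-part of H is cyclic, and M/2 kills H only if #H ∣ M/2 (`smul_half_eq_zero_iff`).
--
-- The sum over ℤ/N is defined by lines, and its group axioms are not proved directly. They are
-- imported from E(ℚ_p): a line through p-adic points descends to ℤ_p (`VCut.descend`) and then
-- reduces modulo p^e, the third intersection point over a local ring is unique when the
-- discriminant is a unit (`VCut.unique`), and Hensel lifting makes the reduction surjective. So
-- E(ℤ/p^e) is an additive image of a group (`exists_reduction`), and E(ℤ/N) is assembled from these
-- by the Chinese remainder theorem (`exists_isAdditive_of_map`).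

theorem isPrimitive_iff {v : Fin 3 → R} :
    IsPrimitive v ↔ ∃ a b c : R, a * v 0 + b * v 1 + c * v 2 = 1 := by
  rw [IsPrimitive, Ideal.eq_top_iff_one, Ideal.mem_span_range_iff_exists_fun]
  simp only [Fin.sum_univ_three]
  exact ⟨fun ⟨c, hc⟩ => ⟨c 0, c 1, c 2, hc⟩, fun ⟨a, b, c, h⟩ => ⟨![a, b, c], by simpa using h⟩⟩

theorem isPrimitive_of_isUnit {v : Fin 3 → R} (k : Fin 3) (h : IsUnit (v k)) : IsPrimitive v :=
  Ideal.eq_top_of_isUnit_mem _ (Ideal.subset_span ⟨k, rfl⟩) h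

theorem IsPrimitive.exists_isUnit [IsLocalRing R] {v : Fin 3 → R} (h : IsPrimitive v) :
    ∃ k, IsUnit (v k) := by
  by_contra! hk
  obtain ⟨a, b, c, h⟩ := isPrimitive_iff.1 h
  have hm (k : Fin 3) : v k ∈ IsLocalRing.maximalIdeal R := hk k
  refine (Ideal.ne_top_iff_one _).1 (IsLocalRing.maximalIdeal.isMaximal R).ne_top ?_
  rw [← h]
  exact add_mem (add_mem (Ideal.mul_mem_left _ _ (hm 0)) (Ideal.mul_mem_left _ _ (hm 1)))
    (Ideal.mul_mem_left _ _ (hm 2))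

theorem IsPrimitive.map (f : R →+* S) {v : Fin 3 → R} (h : IsPrimitive v) :
    IsPrimitive (f ∘ v) := by
  obtain ⟨a, b, c, h⟩ := isPrimitive_iff.1 h
  exact isPrimitive_iff.2 ⟨f a, f b, f c, by simp [← map_mul, ← map_add, h]⟩

theorem IsPrimitive.ne_zero [Nontrivial R] {v : Fin 3 → R} (h : IsPrimitive v) : v ≠ 0 := by
  rintro rfl
  obtain ⟨a, b, c, h⟩ := isPrimitive_iff.1 h
  simp at h

theorem IsPrimitive.smul {v : Fin 3 → R} (h : IsPrimitive v) {u : R} (hu : IsUnit u) :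
    IsPrimitive (u • v) := by
  obtain ⟨a, b, c, h⟩ := isPrimitive_iff.1 h
  obtain ⟨w, hw⟩ := hu.exists_left_inv
  refine isPrimitive_iff.2 ⟨a * w, b * w, c * w, ?_⟩
  simp only [Pi.smul_apply, smul_eq_mul]
  linear_combination (a * v 0 + b * v 1 + c * v 2) * hw + h

theorem map_crossProduct (f : R →+* S) (A B : Fin 3 → R) :
    crossProduct (f ∘ A) (f ∘ B) = f ∘ crossProduct A B := by
  ext i
  fin_cases i <;> simp [cross_apply]

/-! ### The Weierstrass cubic form and its polarization -/

variable (W : WeierstrassCurve R)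

/-- The homogeneous Weierstrass cubic. -/
def cub (v : Fin 3 → R) : R :=
  v 1 ^ 2 * v 2 + W.a₁ * v 0 * v 1 * v 2 + W.a₃ * v 1 * v 2 ^ 2
    - (v 0 ^ 3 + W.a₂ * v 0 ^ 2 * v 2 + W.a₄ * v 0 * v 2 ^ 2 + W.a₆ * v 2 ^ 3)

/-- The gradient of the homogeneous Weierstrass cubic. -/
def grad (v : Fin 3 → R) : Fin 3 → R :=
  ![W.a₁ * v 1 * v 2 - (3 * v 0 ^ 2 + 2 * W.a₂ * v 0 * v 2 + W.a₄ * v 2 ^ 2),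
    2 * v 1 * v 2 + W.a₁ * v 0 * v 2 + W.a₃ * v 2 ^ 2,
    v 1 ^ 2 + W.a₁ * v 0 * v 1 + 2 * W.a₃ * v 1 * v 2
      - (W.a₂ * v 0 ^ 2 + 2 * W.a₄ * v 0 * v 2 + 3 * W.a₆ * v 2 ^ 2)]

/-- The derivative of the homogeneous Weierstrass cubic at `u` in the direction `v`. -/
def pol (u v : Fin 3 → R) : R :=
  grad W u 0 * v 0 + grad W u 1 * v 1 + grad W u 2 * v 2

variable {W}

theorem equation_iff_cub {v : Fin 3 → R} : W.toProjective.Equation v ↔ cub W v = 0 :=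
  WeierstrassCurve.Projective.equation_iff v

/-- The coefficients along a line are values and directional derivatives, so all line computations
run on `cub` and `pol` without dividing by 2 or 3. -/
theorem cub_lin (A B : Fin 3 → R) (s t : R) :
    cub W (s • A + t • B) =
      s ^ 3 * cub W A + s ^ 2 * t * pol W A B + s * t ^ 2 * pol W B A + t ^ 3 * cub W B := by
  simp [cub, pol, grad]
  ring

theorem pol_lin (A B : Fin 3 → R) (s t s' t' : R) :
    pol W (s • A + t • B) (s' • A + t' • B) =
      3 * s ^ 2 * s' * cub W A + (s ^ 2 * t' + 2 * s * t * s') * pol W A B +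
        (2 * s * t * t' + t ^ 2 * s') * pol W B A + 3 * t ^ 2 * t' * cub W B := by
  simp [cub, pol, grad]
  ring

theorem pol_self (A : Fin 3 → R) : pol W A A = 3 * cub W A := by
  simp [cub, pol, grad]
  ring

theorem pol_add_smul (A B C : Fin 3 → R) (t : R) :
    pol W A (B + t • C) = pol W A B + t * pol W A C := by
  simp [pol]
  ring

theorem cub_smul (A : Fin 3 → R) (s : R) : cub W (s • A) = s ^ 3 * cub W A := by
  simp [cub]
  ring

theorem cub_map (f : R →+* S) (v : Fin 3 → R) : cub (W.map f) (f ∘ v) = f (cub W v) := by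
  simp [cub]

theorem grad_map (f : R →+* S) (v : Fin 3 → R) : grad (W.map f) (f ∘ v) = f ∘ grad W v := by
  ext i
  fin_cases i <;> simp [grad, map_ofNat]

theorem pol_map (f : R →+* S) (u v : Fin 3 → R) :
    pol (W.map f) (f ∘ u) (f ∘ v) = f (pol W u v) := by
  simp [pol, grad_map]

theorem aeval_polynomial_line (A B : Fin 3 → R) :
    aeval (fun i => C (A i) * X 0 + C (B i) * X 1) W.toProjective.polynomial =
      (C (cub W A) * X 0 ^ 3 + C (pol W A B) * X 0 ^ 2 * X 1 + C (pol W B A) * X 0 * X 1 ^ 2 +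
        C (cub W B) * X 1 ^ 3 : MvPolynomial (Fin 2) R) := by
  simp [WeierstrassCurve.Projective.polynomial, cub, pol, grad, map_ofNat]
  ring

/-- Setting the second variable to 1 loses nothing for forms of fixed degree. -/
theorem binaryCubic_ext {a b c d a' b' c' d' : R}
    (h : (C a * X 0 ^ 3 + C b * X 0 ^ 2 * X 1 + C c * X 0 * X 1 ^ 2 + C d * X 1 ^ 3 :
        MvPolynomial (Fin 2) R) =
      C a' * X 0 ^ 3 + C b' * X 0 ^ 2 * X 1 + C c' * X 0 * X 1 ^ 2 + C d' * X 1 ^ 3) :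
    a = a' ∧ b = b' ∧ c = c' ∧ d = d' := by
  have h2 := congrArg (aeval ![(Polynomial.X : Polynomial R), 1]) h
  simp at h2
  have h3 : Cubic.toPoly ⟨a, b, c, d⟩ = Cubic.toPoly ⟨a', b', c', d'⟩ := h2
  simpa using (Cubic.toPoly_injective _ _).1 h3

/-! ### Lines through three points of the cubic, in coordinates -/

variable (W) in
/-- The coefficients of the cubic restricted to the line through `A` and `B` are those of `c` times
the product of the linear forms vanishing at the given parameters. -/
structure LineData (A B : Fin 3 → R) (p₁ p₂ q₁ q₂ t₁ t₂ c : R) : Prop where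
  e0 : cub W A = c * (p₂ * q₂ * t₂)
  e1 : pol W A B = -c * (p₁ * q₂ * t₂ + p₂ * q₁ * t₂ + p₂ * q₂ * t₁)
  e2 : pol W B A = c * (p₁ * q₁ * t₂ + p₁ * q₂ * t₁ + p₂ * q₁ * t₁)
  e3 : cub W B = -c * (p₁ * q₁ * t₁)

/-- Turns the polynomial identity of `CutByLine` into four scalar equations, which ring
homomorphisms preserve and `linear_combination` can handle. -/
theorem lineData_iff {A B : Fin 3 → R} {p₁ p₂ q₁ q₂ t₁ t₂ c : R} :
    LineData W A B p₁ p₂ q₁ q₂ t₁ t₂ c ↔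
    aeval (fun i => C (A i) * X 0 + C (B i) * X 1) W.toProjective.polynomial =
      (C c * ((C p₂ * X 0 - C p₁ * X 1) * (C q₂ * X 0 - C q₁ * X 1) * (C t₂ * X 0 - C t₁ * X 1)) :
        MvPolynomial (Fin 2) R) := by
  have h : (C c * ((C p₂ * X 0 - C p₁ * X 1) * (C q₂ * X 0 - C q₁ * X 1) *
        (C t₂ * X 0 - C t₁ * X 1)) : MvPolynomial (Fin 2) R) =
      C (c * (p₂ * q₂ * t₂)) * X 0 ^ 3 +
        C (-c * (p₁ * q₂ * t₂ + p₂ * q₁ * t₂ + p₂ * q₂ * t₁)) * X 0 ^ 2 * X 1 +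
        C (c * (p₁ * q₁ * t₂ + p₁ * q₂ * t₁ + p₂ * q₁ * t₁)) * X 0 * X 1 ^ 2 +
        C (-c * (p₁ * q₁ * t₁)) * X 1 ^ 3 := by
    simp only [C_mul, C_add, C_neg]
    ring
  rw [aeval_polynomial_line, h]
  constructor
  · rintro ⟨h0, h1, h2, h3⟩
    rw [h0, h1, h2, h3]
  · intro h
    obtain ⟨h0, h1, h2, h3⟩ := binaryCubic_ext h
    exact ⟨h0, h1, h2, h3⟩

variable (W) in
/-- The cubic meets some line in the three points with coordinate vectors `u`, `v`, `w`. -/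
def VCut (u v w : Fin 3 → R) : Prop :=
  ∃ (A B : Fin 3 → R) (p₁ p₂ q₁ q₂ t₁ t₂ c : R), IsUnit c ∧ IsPrimitive (crossProduct A B) ∧
    u = p₁ • A + p₂ • B ∧ v = q₁ • A + q₂ • B ∧ w = t₁ • A + t₂ • B ∧
    LineData W A B p₁ p₂ q₁ q₂ t₁ t₂ c

theorem VCut.swap {u v w : Fin 3 → R} (h : VCut W u v w) : VCut W v u w := by
  obtain ⟨A, B, p₁, p₂, q₁, q₂, t₁, t₂, c, hc, hAB, hu, hv, hw, h0, h1, h2, h3⟩ := h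
  refine ⟨A, B, q₁, q₂, p₁, p₂, t₁, t₂, c, hc, hAB, hv, hu, hw, ?_, ?_, ?_, ?_⟩
  · rw [h0]; ring
  · rw [h1]; ring
  · rw [h2]; ring
  · rw [h3]; ring

/-- Rescaling the three vectors is absorbed by the constant `c`; hence the condition depends only on
the points, as `cutByLine_iff` records. -/
theorem VCut.smul {u v w : Fin 3 → R} (h : VCut W u v w) {a b c : R} (ha : IsUnit a)
    (hb : IsUnit b) (hc : IsUnit c) : VCut W (a • u) (b • v) (c • w) := by
  obtain ⟨A, B, p₁, p₂, q₁, q₂, t₁, t₂, d, hd, hAB, rfl, rfl, rfl, h0, h1, h2, h3⟩ := h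
  obtain ⟨e, he⟩ := ((ha.mul hb).mul hc).exists_left_inv
  refine ⟨A, B, a * p₁, a * p₂, b * q₁, b * q₂, c * t₁, c * t₂, d * e,
    hd.mul (.of_mul_eq_one _ he), hAB, ?_, ?_, ?_, ?_, ?_, ?_, ?_⟩
  · simp [smul_smul]
  · simp [smul_smul]
  · simp [smul_smul]
  · linear_combination h0 - d * (p₂ * q₂ * t₂) * he
  · linear_combination h1 + d * (p₁ * q₂ * t₂ + p₂ * q₁ * t₂ + p₂ * q₂ * t₁) * he
  · linear_combination h2 - d * (p₁ * q₁ * t₂ + p₁ * q₂ * t₁ + p₂ * q₁ * t₁) * he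
  · linear_combination h3 + d * (p₁ * q₁ * t₁) * he

theorem LineData.map (f : R →+* S) {A B : Fin 3 → R} {p₁ p₂ q₁ q₂ t₁ t₂ c : R}
    (h : LineData W A B p₁ p₂ q₁ q₂ t₁ t₂ c) :
    LineData (W.map f) (f ∘ A) (f ∘ B) (f p₁) (f p₂) (f q₁) (f q₂) (f t₁) (f t₂) (f c) := by
  obtain ⟨h0, h1, h2, h3⟩ := h
  constructor <;> simp only [cub_map, pol_map, h0, h1, h2, h3] <;> simp

theorem comp_smul_add_smul (f : R →+* S) (A B : Fin 3 → R) (s t : R) :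
    f ∘ (s • A + t • B) = f s • (f ∘ A) + f t • (f ∘ B) := by
  ext i
  simp

theorem VCut.map (f : R →+* S) {u v w : Fin 3 → R} (h : VCut W u v w) :
    VCut (W.map f) (f ∘ u) (f ∘ v) (f ∘ w) := by
  obtain ⟨A, B, p₁, p₂, q₁, q₂, t₁, t₂, d, hd, hAB, rfl, rfl, rfl, h⟩ := h
  refine ⟨f ∘ A, f ∘ B, f p₁, f p₂, f q₁, f q₂, f t₁, f t₂, f d, hd.map f, ?_,
    comp_smul_add_smul .., comp_smul_add_smul .., comp_smul_add_smul .., h.map f⟩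
  rw [map_crossProduct]
  exact hAB.map f

/-! ### Points and their homogeneous coordinates -/

theorem Points.isRep_iff {P : Points W} {v w : Fin 3 → R} (hv : P.IsRep v) :
    P.IsRep w ↔ ∃ e : R, IsUnit e ∧ w = e • v := by
  unfold Points.IsRep at *
  rw [hv, Quotient.eq]
  constructor
  · rintro ⟨e, he⟩
    exact ⟨_, (e⁻¹).isUnit, by rw [← he, ← Units.smul_def, inv_smul_smul]⟩
  · rintro ⟨e, ⟨e, rfl⟩, rfl⟩
    exact ⟨e⁻¹, by simp [← Units.smul_def]⟩

theorem Points.exists_isRep (P : Points W) :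
    ∃ v, P.IsRep v ∧ IsPrimitive v ∧ cub W v = 0 := by
  obtain ⟨v, h, hv, h'⟩ := P.2
  exact ⟨v, h, hv, equation_iff_cub.1 h'⟩

theorem Points.IsRep.isPrimitive {P : Points W} {v : Fin 3 → R} (h : P.IsRep v) :
    IsPrimitive v := by
  obtain ⟨w, hw, hw', -⟩ := P.exists_isRep
  obtain ⟨e, he, rfl⟩ := (Points.isRep_iff hw).1 h
  exact hw'.smul he

theorem Points.IsRep.cub_eq {P : Points W} {v : Fin 3 → R} (h : P.IsRep v) : cub W v = 0 := by
  obtain ⟨w, hw, -, hw'⟩ := P.exists_isRep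
  obtain ⟨e, he, rfl⟩ := (Points.isRep_iff hw).1 h
  rw [cub_smul, hw', mul_zero]

theorem Points.eq_of_isRep {P Q : Points W} {v w : Fin 3 → R} (hv : P.IsRep v) (hw : Q.IsRep w)
    {e : R} (he : IsUnit e) (h : w = e • v) : P = Q := by
  have : P.IsRep w := (Points.isRep_iff hv).2 ⟨e, he, h⟩
  exact Subtype.ext (this.trans hw.symm)

/-- The point with given homogeneous coordinates. -/
def Points.ofRep (v : Fin 3 → R) (hv : IsPrimitive v) (h : cub W v = 0) : Points W :=
  ⟨Quotient.mk _ v, v, rfl, hv, equation_iff_cub.2 h⟩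

theorem Points.isRep_ofRep (v : Fin 3 → R) (hv : IsPrimitive v) (h : cub W v = 0) :
    (Points.ofRep v hv h).IsRep v := rfl

theorem Points.isRep_zero : (0 : Points W).IsRep ![0, 1, 0] := rfl

theorem Points.IsRep.neg {P : Points W} {v : Fin 3 → R} (h : P.IsRep v) :
    (-P).IsRep (W.toProjective.neg v) := by
  obtain ⟨P, hP⟩ := P
  change P = _ at h
  subst h
  rfl

theorem neg_eq {v : Fin 3 → R} :
    W.toProjective.neg v = ![v 0, -v 1 - W.a₁ * v 0 - W.a₃ * v 2, v 2] := rfl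

theorem neg_neg_rep (v : Fin 3 → R) : W.toProjective.neg (W.toProjective.neg v) = v := by
  ext i
  fin_cases i <;> simp [neg_eq]
  ring

theorem Points.neg_neg (P : Points W) : - -P = P := by
  obtain ⟨v, hv, -⟩ := P.exists_isRep
  refine Points.eq_of_isRep hv.neg.neg hv isUnit_one ?_
  rw [neg_neg_rep, one_smul]

theorem cutByLine_iff {P Q T : Points W} {u v w : Fin 3 → R} (hu : P.IsRep u) (hv : Q.IsRep v)
    (hw : T.IsRep w) : CutByLine P Q T ↔ VCut W u v w := by
  constructor
  · rintro ⟨A, B, p₁, p₂, q₁, q₂, t₁, t₂, c, hAB, hP, hQ, hT, h⟩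
    obtain ⟨a, ha, rfl⟩ := (Points.isRep_iff hP).1 hu
    obtain ⟨b, hb, rfl⟩ := (Points.isRep_iff hQ).1 hv
    obtain ⟨d, hd, rfl⟩ := (Points.isRep_iff hT).1 hw
    exact VCut.smul ⟨A, B, p₁, p₂, q₁, q₂, t₁, t₂, c, c.isUnit, hAB, rfl, rfl, rfl,
      lineData_iff.2 h⟩ ha hb hd
  · rintro ⟨A, B, p₁, p₂, q₁, q₂, t₁, t₂, c, ⟨c, rfl⟩, hAB, rfl, rfl, rfl, h⟩
    exact ⟨A, B, p₁, p₂, q₁, q₂, t₁, t₂, c, hAB, hu, hv, hw, lineData_iff.1 h⟩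

/-- The map on points induced by a ring homomorphism. -/
noncomputable def Points.map (f : R →+* S) {W' : WeierstrassCurve S} (h : W.map f = W')
    (P : Points W) : Points W' :=
  Points.ofRep (f ∘ P.exists_isRep.choose) (P.exists_isRep.choose_spec.2.1.map f) <| by
    rw [← h, cub_map, P.exists_isRep.choose_spec.2.2, map_zero]

theorem Points.IsRep.map (f : R →+* S) {W' : WeierstrassCurve S} (h : W.map f = W')
    {P : Points W} {v : Fin 3 → R} (hv : P.IsRep v) : (P.map f h).IsRep (f ∘ v) := by
  obtain ⟨e, he, rfl⟩ := (Points.isRep_iff P.exists_isRep.choose_spec.1).1 hv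
  refine (Points.isRep_iff (Points.isRep_ofRep _ _ _)).2 ⟨f e, he.map f, ?_⟩
  ext i
  simp

theorem CutByLine.map (f : R →+* S) {W' : WeierstrassCurve S} (h : W.map f = W')
    {P Q T : Points W} (hc : CutByLine P Q T) :
    CutByLine (P.map f h) (Q.map f h) (T.map f h) := by
  obtain ⟨u, hu, -⟩ := P.exists_isRep
  obtain ⟨v, hv, -⟩ := Q.exists_isRep
  obtain ⟨w, hw, -⟩ := T.exists_isRep
  subst h
  rw [cutByLine_iff (hu.map f rfl) (hv.map f rfl) (hw.map f rfl)]
  exact VCut.map f ((cutByLine_iff hu hv hw).1 hc)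

theorem comp_neg (f : R →+* S) (v : Fin 3 → R) :
    f ∘ W.toProjective.neg v = (W.map f).toProjective.neg (f ∘ v) := by
  ext i
  fin_cases i <;> simp [neg_eq]

theorem Points.map_neg (f : R →+* S) {W' : WeierstrassCurve S} (h : W.map f = W')
    (P : Points W) : (-P).map f h = -(P.map f h) := by
  obtain ⟨u, hu, -⟩ := P.exists_isRep
  refine Points.eq_of_isRep (hu.neg.map f h) (hu.map f h).neg isUnit_one ?_
  subst h
  rw [one_smul, comp_neg]

theorem Points.map_zero (f : R →+* S) {W' : WeierstrassCurve S} (h : W.map f = W') :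
    (0 : Points W).map f h = 0 := by
  refine Points.eq_of_isRep (Points.isRep_zero.map f h) Points.isRep_zero isUnit_one ?_
  ext i
  fin_cases i <;> simp

theorem Points.map_map {T : Type*} [CommRing T] (f : R →+* S) (g : S →+* T)
    {W' : WeierstrassCurve S} {W'' : WeierstrassCurve T} (h : W.map f = W') (h' : W'.map g = W'')
    (h'' : W.map (g.comp f) = W'') (P : Points W) :
    (P.map f h).map g h' = P.map (g.comp f) h'' := by
  obtain ⟨u, hu, -⟩ := P.exists_isRep
  refine Points.eq_of_isRep ((hu.map f h).map g h') (hu.map _ h'') isUnit_one ?_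
  rw [one_smul]
  rfl

end Basic

/-! ### Uniqueness of the third intersection point over a local ring -/

section Uniqueness

variable {R : Type*} [CommRing R] {W : WeierstrassCurve R}

/-- The parameters are multiplied by a 2 × 2 matrix and the basis by `e` times its adjugate. When
`e` inverts the determinant, the points themselves do not move. -/
theorem LineData.reparam {A B : Fin 3 → R} {p₁ p₂ q₁ q₂ t₁ t₂ c : R}
    (h : LineData W A B p₁ p₂ q₁ q₂ t₁ t₂ c) (a b a' b' e : R) :
    LineData W ((e * b') • A + (-(e * b)) • B) ((-(e * a')) • A + (e * a) • B)
      (p₁ * a + p₂ * a') (p₁ * b + p₂ * b') (q₁ * a + q₂ * a') (q₁ * b + q₂ * b')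
      (t₁ * a + t₂ * a') (t₁ * b + t₂ * b') (c * e ^ 3) := by
  obtain ⟨h0, h1, h2, h3⟩ := h
  constructor
  · rw [cub_lin, h0, h1, h2, h3]; ring
  · rw [pol_lin, h0, h1, h2, h3]; ring
  · rw [pol_lin, h0, h1, h2, h3]; ring
  · rw [cub_lin, h0, h1, h2, h3]; ring

/-- A cubic restricted to a line through a point of the cubic, with that point as the first base
point of the line. -/
theorem VCut.exists_base {u v w : Fin 3 → R} (hu : ∃ a b c, a * u 0 + b * u 1 + c * u 2 = 1)
    (h : VCut W u v w) :
    ∃ (B : Fin 3 → R) (q₁ q₂ t₁ t₂ c : R), IsUnit c ∧ IsPrimitive (crossProduct u B) ∧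
      v = q₁ • u + q₂ • B ∧ w = t₁ • u + t₂ • B ∧ LineData W u B 1 0 q₁ q₂ t₁ t₂ c := by
  obtain ⟨A, B, p₁, p₂, q₁, q₂, t₁, t₂, c, hc, hAB, rfl, rfl, rfl, hd⟩ := h
  -- Primitivity of the point makes its parameters unimodular, so they complete to a matrix of
  -- determinant 1 carrying them to (1, 0).
  obtain ⟨x, y, hxy⟩ : ∃ x y : R, x * p₁ + y * p₂ = 1 := by
    obtain ⟨a, b, c, h⟩ := hu
    refine ⟨a * A 0 + b * A 1 + c * A 2, a * B 0 + b * B 1 + c * B 2, ?_⟩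
    simp only [Pi.add_apply, Pi.smul_apply, smul_eq_mul] at h
    linear_combination h
  have key := hd.reparam x (-p₂) y p₁ 1
  have h0 : -(1 * -p₂) = p₂ := by ring
  have h1 : p₁ * x + p₂ * y = 1 := by linear_combination hxy
  have h2 : p₁ * -p₂ + p₂ * p₁ = 0 := by ring
  rw [one_mul, h0, h1, h2] at key
  have hlin (s t : R) : s • A + t • B = (s * x + t * y) • (p₁ • A + p₂ • B) +
      (s * -p₂ + t * p₁) • ((-(1 * y)) • A + (1 * x) • B) := by
    ext i
    simp only [Pi.add_apply, Pi.smul_apply, smul_eq_mul]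
    linear_combination -(s * A i + t * B i) * hxy
  refine ⟨_, _, _, _, _, _, by simpa using hc, ?_, hlin _ _, hlin _ _, key⟩
  convert! hAB using 1
  ext i
  fin_cases i <;> simp [cross_apply]
  · linear_combination (A 1 * B 2 - A 2 * B 1) * hxy
  · linear_combination (A 2 * B 0 - A 0 * B 2) * hxy
  · linear_combination (A 0 * B 1 - A 1 * B 0) * hxy

theorem dvd_pol_sub (B D u : Fin 3 → R) (γ : R) :
    γ ∣ pol W (B + γ • D) u - pol W B u := by
  rw [← Ideal.mem_span_singleton, ← Ideal.Quotient.eq, ← pol_map, ← pol_map]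
  congr 1
  ext i
  simp

theorem dvd_cub_sub (B D : Fin 3 → R) (γ : R) : γ ∣ cub W (B + γ • D) - cub W B := by
  rw [← Ideal.mem_span_singleton, ← Ideal.Quotient.eq, ← cub_map, ← cub_map]
  congr 1
  ext i
  simp

/-- The `k`-th coordinate of u × B is det(u, B, e_k) up to a cyclic permutation, so `u`, `B`, `e_k`
are independent when it is a unit. -/
theorem eq_zero_of_lin {u B : Fin 3 → R} {k : Fin 3} (hk : IsUnit (crossProduct u B k))
    {x y z : R} (h : x • u + y • B + z • Pi.single k 1 = 0) : x = 0 ∧ y = 0 ∧ z = 0 := by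
  have h0 := congrFun h 0
  have h1 := congrFun h 1
  have h2 := congrFun h 2
  have hxy : x = 0 ∧ y = 0 := by
    rw [← hk.mul_right_eq_zero (b := x), ← hk.mul_right_eq_zero (b := y)]
    fin_cases k <;> simp [cross_apply] at h0 h1 h2 ⊢
    · exact ⟨by linear_combination B 2 * h1 - B 1 * h2, by linear_combination u 1 * h2 - u 2 * h1⟩
    · exact ⟨by linear_combination B 0 * h2 - B 2 * h0, by linear_combination u 2 * h0 - u 0 * h2⟩
    · exact ⟨by linear_combination B 1 * h0 - B 0 * h1, by linear_combination u 0 * h1 - u 1 * h0⟩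
  obtain ⟨rfl, rfl⟩ := hxy
  refine ⟨rfl, rfl, ?_⟩
  simpa using congrFun h k

/-- Cramer's rule for `B'` in terms of `u`, `B`, `e_k`; here γ is det(u, B, B'). -/
theorem cross_lin (u B B' : Fin 3 → R) (k : Fin 3) :
    ∃ γ : R, crossProduct u B k • B' =
      crossProduct B' B k • u + crossProduct u B' k • B + γ • Pi.single k 1 := by
  refine ⟨B' 0 * (u 1 * B 2 - u 2 * B 1) + B' 1 * (u 2 * B 0 - u 0 * B 2) +
    B' 2 * (u 0 * B 1 - u 1 * B 0), ?_⟩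
  ext i
  fin_cases k <;> fin_cases i <;> simp [cross_apply] <;> ring

/-- The gradient at a point of a line determines a unit coordinate of the normal vector of the
line, when the line is tangent modulo the maximal ideal. -/
theorem isUnit_cross_of_grad [IsLocalRing R] {l u B : Fin 3 → R} {k : Fin 3} (hk : IsUnit (l k))
    (hu : l 0 * u 0 + l 1 * u 1 + l 2 * u 2 = 0)
    (hB : ¬ IsUnit (l 0 * B 0 + l 1 * B 1 + l 2 * B 2)) (hn : IsPrimitive (crossProduct u B)) :
    IsUnit (crossProduct u B k) := by
  by_contra hnk
  obtain ⟨j, hj⟩ := hn.exists_isUnit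
  have hm (z : R) : ¬ IsUnit z ↔ z ∈ IsLocalRing.maximalIdeal R := Iff.rfl
  rw [hm] at hB hnk
  have key : crossProduct u B j * l k ∈ IsLocalRing.maximalIdeal R := by
    have h1 (r : R) := Ideal.mul_mem_left _ r hB
    have h2 (r : R) := Ideal.mul_mem_left _ r hnk
    -- Both `l` and u × B annihilate `u` and `B` modulo the maximal ideal, so they are proportional
    -- there and their 2 × 2 minors lie in it.
    have hjk : crossProduct u B j * l k - l j * crossProduct u B k ∈ IsLocalRing.maximalIdeal R := by
      have e (r s : R) (h : crossProduct u B j * l k - l j * crossProduct u B k =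
          r * (l 0 * B 0 + l 1 * B 1 + l 2 * B 2) + s * (l 0 * u 0 + l 1 * u 1 + l 2 * u 2)) :
          crossProduct u B j * l k - l j * crossProduct u B k ∈ IsLocalRing.maximalIdeal R := by
        rw [h, hu, mul_zero, add_zero]
        exact h1 r
      fin_cases j <;> fin_cases k
      · exact e 0 0 (by simp; ring)
      · exact e (-u 2) (B 2) (by simp [cross_apply]; ring)
      · exact e (u 1) (-B 1) (by simp [cross_apply]; ring)
      · exact e (u 2) (-B 2) (by simp [cross_apply]; ring)
      · exact e 0 0 (by simp; ring)
      · exact e (-u 0) (B 0) (by simp [cross_apply]; ring)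
      · exact e (-u 1) (B 1) (by simp [cross_apply]; ring)
      · exact e (u 0) (-B 0) (by simp [cross_apply]; ring)
      · exact e 0 0 (by simp; ring)
    simpa using add_mem hjk (h2 (l j))
  exact key (hj.mul hk)

theorem exists_grad_ne_zero {F : Type*} [Field F] {W : WeierstrassCurve F} (hΔ : W.Δ ≠ 0)
    {v : Fin 3 → F} (hv : v ≠ 0) (h : cub W v = 0) : ∃ k, grad W v k ≠ 0 := by
  have hns : W.toProjective.Nonsingular v := by
    by_cases hz : v 2 = 0
    · rw [WeierstrassCurve.Projective.nonsingular_of_Z_eq_zero hz]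
      have h' := equation_iff_cub.2 h
      have hx := WeierstrassCurve.Projective.X_eq_zero_of_Z_eq_zero h' hz
      refine ⟨h', Or.inr ?_⟩
      rw [hx]
      have : v 1 ≠ 0 := fun hy => hv (by ext i; fin_cases i <;> assumption)
      simpa using this
    · rw [WeierstrassCurve.Projective.nonsingular_of_Z_ne_zero hz,
        ← WeierstrassCurve.Affine.equation_iff_nonsingular_of_Δ_ne_zero hΔ,
        ← WeierstrassCurve.Projective.equation_of_Z_ne_zero hz]
      exact equation_iff_cub.2 h
  rcases ((WeierstrassCurve.Projective.nonsingular_iff v).1 hns).2 with h | h | h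
  · exact ⟨0, h⟩
  · exact ⟨1, h⟩
  · exact ⟨2, h⟩

theorem exists_isUnit_grad [IsLocalRing R] (hΔ : IsUnit W.Δ) {v : Fin 3 → R} (hv : IsPrimitive v)
    (h : cub W v = 0) : ∃ k, IsUnit (grad W v k) := by
  let f := IsLocalRing.residue R
  obtain ⟨k, hk⟩ := exists_grad_ne_zero (W := W.map f) (v := f ∘ v)
    (by rw [WeierstrassCurve.map_Δ]; exact (hΔ.map f).ne_zero) (hv.map f).ne_zero
    (by rw [cub_map, h, map_zero])
  refine ⟨k, ?_⟩
  rw [grad_map] at hk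
  exact (IsLocalRing.residue_ne_zero_iff_isUnit _).1 hk

theorem not_isUnit_mul_right [IsLocalRing R] {a b : R} (h : ¬ IsUnit b) : ¬ IsUnit (a * b) :=
  fun h' => h (isUnit_of_mul_isUnit_right h')

/-- The residual intersection formula for the line through two points that are distinct modulo the
maximal ideal. -/
theorem VCut.chord {u v w : Fin 3 → R} (h : VCut W u v w) {k : Fin 3}
    (hk : IsUnit (crossProduct u v k)) :
    ∃ e : R, IsUnit e ∧ e • w = pol W v u • u - pol W u v • v := by
  obtain ⟨A, B, p₁, p₂, q₁, q₂, t₁, t₂, c, hc, hAB, rfl, rfl, rfl, h0, h1, h2, h3⟩ := h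
  have ho : IsUnit (p₁ * q₂ - p₂ * q₁) := by
    have : crossProduct (p₁ • A + p₂ • B) (q₁ • A + q₂ • B) k =
        (p₁ * q₂ - p₂ * q₁) * crossProduct A B k := by
      fin_cases k <;> simp [cross_apply] <;> ring
    rw [this] at hk
    exact isUnit_of_mul_isUnit_left hk
  refine ⟨c * (p₁ * q₂ - p₂ * q₁) ^ 3, hc.mul (ho.pow 3), ?_⟩
  rw [pol_lin, pol_lin, h0, h1, h2, h3]
  ext i
  simp only [Pi.add_apply, Pi.sub_apply, Pi.smul_apply, smul_eq_mul]
  ring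

/-- Points distinct modulo the maximal ideal are handled by the chord formula. Otherwise both lines
are tangent at `u` modulo the maximal ideal, and a unit coordinate `k` of the gradient lets the
second line be spanned by `u` and a perturbation B + g e_k. That both lines pass through `v` and
meet the cubic there as prescribed forces g = 0. -/
theorem VCut.unique [IsLocalRing R] (hΔ : IsUnit W.Δ) {u v w w' : Fin 3 → R} (hu : IsPrimitive u)
    (hv : IsPrimitive v) (hcu : cub W u = 0) (h : VCut W u v w) (h' : VCut W u v w') :
    ∃ e : R, IsUnit e ∧ w' = e • w := by
  by_cases hx : ∃ k, IsUnit (crossProduct u v k)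
  · obtain ⟨k, hk⟩ := hx
    obtain ⟨a, ha, h⟩ := h.chord hk
    obtain ⟨b, hb, h'⟩ := h'.chord hk
    obtain ⟨d, hd⟩ := hb.exists_left_inv
    refine ⟨d * a, (IsUnit.of_mul_eq_one _ hd).mul ha, ?_⟩
    rw [← smul_smul, h, ← h', smul_smul, hd, one_smul]
  push Not at hx
  obtain ⟨B, q₁, q₂, t₁, t₂, c, hc, hn, hv1, hw, hd⟩ := h.exists_base (isPrimitive_iff.1 hu)
  obtain ⟨B', q₁', q₂', t₁', t₂', c', hc', hn', hv2, hw', hd'⟩ :=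
    h'.exists_base (isPrimitive_iff.1 hu)
  -- Here u × v = q₂ (u × B), and no coordinate of u × v is a unit.
  have hnon {B : Fin 3 → R} {q₁ q₂ : R} (hn : IsPrimitive (crossProduct u B))
      (hv : v = q₁ • u + q₂ • B) : ¬ IsUnit q₂ := by
    intro hq
    obtain ⟨k, hk⟩ := hn.exists_isUnit
    refine hx k ?_
    have : crossProduct u v k = q₂ * crossProduct u B k := by
      rw [hv]
      fin_cases k <;> simp [cross_apply] <;> ring
    rw [this]
    exact hq.mul hk
  have hq := hnon hn hv1
  have hq' := hnon hn' hv2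
  have hq1 : IsUnit q₁ := by
    by_contra hq1
    obtain ⟨j, hj⟩ := hv.exists_isUnit
    rw [hv1] at hj
    simp only [Pi.add_apply, Pi.smul_apply, smul_eq_mul] at hj
    rw [mul_comm q₁, mul_comm q₂] at hj
    rcases IsLocalRing.isUnit_or_isUnit_of_isUnit_add hj with h | h
    · exact not_isUnit_mul_right hq1 h
    · exact not_isUnit_mul_right hq h
  obtain ⟨k, hk⟩ := exists_isUnit_grad hΔ hu hcu
  have hgu : grad W u 0 * u 0 + grad W u 1 * u 1 + grad W u 2 * u 2 = 0 := by
    have := pol_self (W := W) u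
    rwa [hcu, mul_zero] at this
  have hnk := isUnit_cross_of_grad hk hgu (B := B) (by
    have := hd.e1
    rw [pol] at this
    rw [this, show -c * (1 * q₂ * t₂ + 0 * q₁ * t₂ + 0 * q₂ * t₁) = -c * t₂ * q₂ by ring]
    exact not_isUnit_mul_right hq) hn
  have hnk' := isUnit_cross_of_grad hk hgu (B := B') (by
    have := hd'.e1
    rw [pol] at this
    rw [this, show -c' * (1 * q₂' * t₂' + 0 * q₁' * t₂' + 0 * q₂' * t₁') = -c' * t₂' * q₂' by ring]
    exact not_isUnit_mul_right hq') hn'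
  obtain ⟨γ, hγ⟩ := cross_lin u B B' k
  set n := crossProduct u B k
  set β := crossProduct u B' k
  set α := crossProduct B' B k
  obtain ⟨ni, hni⟩ := hnk.exists_left_inv
  obtain ⟨βi, hβi⟩ := hnk'.exists_left_inv
  have hB' : ((n * βi) * (ni * α)) • u + (-(n * βi)) • B' = -(B + (βi * γ) • Pi.single k 1) := by
    ext i
    have := congrFun hγ i
    simp only [Pi.add_apply, Pi.smul_apply, Pi.neg_apply, smul_eq_mul] at this ⊢
    linear_combination -βi * this - B i * hβi + α * βi * u i * hni
  -- This change of basis gives the second line the basis `u`, B + g e_k, with g = βi * γ.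
  have hrep := hd'.reparam 1 0 (ni * α) (ni * β) (n * βi)
  have e1 : (n * βi * (ni * β)) • u + (-(n * βi * 0)) • B' = u := by
    ext i
    simp only [Pi.add_apply, Pi.smul_apply, smul_eq_mul]
    linear_combination u i * (hni * βi * β + hβi)
  have e2 : (-(n * βi * (ni * α))) • u + (n * βi * 1) • B' = B + (βi * γ) • Pi.single k 1 := by
    rw [← neg_inj, ← hB']
    ext i
    simp only [Pi.add_apply, Pi.smul_apply, Pi.neg_apply, smul_eq_mul]
    ring
  have hB'' : B' = (ni * α) • u + (ni * β) • (B + (βi * γ) • Pi.single k 1) := by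
    ext i
    have := congrFun hγ i
    simp only [Pi.add_apply, Pi.smul_apply, smul_eq_mul] at this ⊢
    linear_combination ni * this - B' i * hni -
      ni * γ * (Pi.single k 1 : Fin 3 → R) i * hβi
  rw [e1, e2] at hrep
  generalize βi * γ = g at hrep hB''
  simp only [mul_one, mul_zero, zero_add, add_zero, zero_mul] at hrep
  rw [hB''] at hv2 hw'
  have hv2' : v = (q₁' + q₂' * (ni * α)) • u + (q₂' * (ni * β)) • (B + g • Pi.single k 1) := by
    rw [hv2, smul_add, smul_smul, smul_smul, add_smul, add_assoc]
  have hw2' : w' = (t₁' + t₂' * (ni * α)) • u + (t₂' * (ni * β)) • (B + g • Pi.single k 1) := by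
    rw [hw', smul_add, smul_smul, smul_smul, add_smul, add_assoc]
  have hce : IsUnit (c' * (n * βi) ^ 3) :=
    hc'.mul ((hnk.mul (.of_mul_eq_one _ (by rw [mul_comm]; exact (mul_comm _ _).trans hβi))).pow 3)
  generalize q₁' + q₂' * (ni * α) = r₁ at hrep hv2'
  generalize q₂' * (ni * β) = r₂ at hrep hv2'
  generalize t₁' + t₂' * (ni * α) = s₁ at hrep hw2'
  generalize t₂' * (ni * β) = s₂ at hrep hw2'
  generalize c' * (n * βi) ^ 3 = d at hrep hce
  -- Comparing the two expressions of `v` in the basis `u`, `B`, `e_k`.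
  obtain ⟨hr1, hr2, hr3⟩ := eq_zero_of_lin (x := r₁ - q₁) (y := r₂ - q₂) (z := r₂ * g) hnk (by
    have := hv2'.symm.trans hv1
    ext i
    have := congrFun this i
    simp only [Pi.add_apply, Pi.smul_apply, smul_eq_mul, Pi.zero_apply] at this ⊢
    linear_combination this)
  obtain rfl : r₁ = q₁ := sub_eq_zero.1 hr1
  obtain rfl : r₂ = q₂ := sub_eq_zero.1 hr2
  obtain rfl : g = 0 := by
    obtain ⟨x, hx⟩ := dvd_pol_sub (W := W) B (Pi.single k 1) u g
    obtain ⟨y, hy⟩ := dvd_cub_sub (W := W) B (Pi.single k 1) g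
    have hpol : pol W u (B + g • Pi.single k 1) = pol W u B + g * grad W u k := by
      rw [pol_add_smul]
      congr 2
      fin_cases k <;> simp [pol]
    have h1 := hd.e1
    have h2 := hd.e2
    have h3 := hd.e3
    have h1' := hrep.e1
    have h2' := hrep.e2
    have h3' := hrep.e3
    -- On either line, the cubic divided by the linear form of `u` vanishes at the parameters (r₁,
    -- r₂) of `v`. Subtracting the two identities, every change caused by `g` carries a factor r₂ g
    -- = 0, except the gradient term.
    have : r₁ ^ 2 * grad W u k * g = 0 := by
      linear_combination -r₁ ^ 2 * hpol + r₁ ^ 2 * h1' - r₁ ^ 2 * h1 + r₁ * r₂ * h2' -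
        r₁ * r₂ * h2 + r₂ ^ 2 * h3' - r₂ ^ 2 * h3 - r₁ * r₂ * hx - r₂ ^ 2 * hy -
        (r₁ * x + r₂ * y) * hr3
    exact ((hq1.pow 2).mul hk).mul_right_eq_zero.1 this
  rw [zero_smul, add_zero] at hrep hw2'
  obtain ⟨di, hdi⟩ := hce.exists_left_inv
  have hs1 : d * s₁ = c * t₁ := by
    have := hd.e3.symm.trans hrep.e3
    refine hq1.mul_left_cancel ?_
    linear_combination this
  have hs2 : d * s₂ = c * t₂ := by
    have := hd.e2.symm.trans hrep.e2
    refine hq1.mul_left_cancel ?_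
    linear_combination -this - r₂ * hs1
  refine ⟨di * c, (IsUnit.of_mul_eq_one _ hdi).mul hc, ?_⟩
  rw [hw2', hw]
  ext i
  simp only [Pi.add_apply, Pi.smul_apply, smul_eq_mul]
  linear_combination di * hs1 * u i + di * hs2 * B i - (s₁ * u i + s₂ * B i) * hdi

theorem CutByLine.unique [IsLocalRing R] (hΔ : IsUnit W.Δ) {P Q T T' : Points W}
    (h : CutByLine P Q T) (h' : CutByLine P Q T') : T = T' := by
  obtain ⟨u, hu, hu', hcu⟩ := P.exists_isRep
  obtain ⟨v, hv, hv', -⟩ := Q.exists_isRep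
  obtain ⟨w, hw, -⟩ := T.exists_isRep
  obtain ⟨w', hw', -⟩ := T'.exists_isRep
  obtain ⟨e, he, h⟩ := VCut.unique hΔ hu' hv' hcu ((cutByLine_iff hu hv hw).1 h)
    ((cutByLine_iff hu hv hw').1 h')
  exact Points.eq_of_isRep hw hw' he h

end Uniqueness

open WeierstrassCurve.Affine (Point)

/-! ### The affine group law over a field as intersection with lines -/

section Field

variable {F : Type*} [Field F] {W : WeierstrassCurve F}

/-- Homogeneous coordinates of a nonsingular affine point or of the point at infinity. -/
def affRep : W.toAffine.Point → Fin 3 → F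
  | .zero => ![0, 1, 0]
  | .some x y _ => ![x, y, 1]

@[simp]
theorem affRep_zero : affRep (0 : W.toAffine.Point) = ![0, 1, 0] := rfl

@[simp]
theorem affRep_some {x y : F} (h : W.toAffine.Nonsingular x y) :
    affRep (.some x y h) = ![x, y, 1] := rfl

theorem affRep_neg (P : W.toAffine.Point) :
    ∃ e : F, e ≠ 0 ∧ affRep (-P) = e • W.toProjective.neg (affRep P) := by
  rcases P with _ | ⟨x, y, h⟩
  · refine ⟨-1, by simp, ?_⟩
    ext i
    change affRep (0 : W.toAffine.Point) i = ((-1 : F) • W.toProjective.neg ![0, 1, 0]) i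
    fin_cases i <;> simp [neg_eq]
  · refine ⟨1, one_ne_zero, ?_⟩
    rw [WeierstrassCurve.Affine.Point.neg_some, affRep_some, one_smul]
    simp [neg_eq, WeierstrassCurve.Affine.negY]

theorem isPrimitive_affRep (P : W.toAffine.Point) : IsPrimitive (affRep P) := by
  rcases P with _ | ⟨x, y, h⟩
  · exact isPrimitive_of_isUnit 1 (by simp [affRep])
  · exact isPrimitive_of_isUnit 2 (by simp)

theorem cub_affRep (P : W.toAffine.Point) : cub W (affRep P) = 0 := by
  rw [← equation_iff_cub]
  rcases P with _ | ⟨x, y, h⟩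
  · exact WeierstrassCurve.Projective.equation_zero
  · exact (WeierstrassCurve.Projective.equation_some x y).2 h.1

theorem affRep_injective {P Q : W.toAffine.Point} {e : F} (h : affRep P = e • affRep Q) :
    P = Q := by
  rcases P with _ | ⟨x, y, hP⟩ <;> rcases Q with _ | ⟨x', y', hQ⟩
  · rfl
  · have h1 := congrFun h 1
    have h2 := congrFun h 2
    simp [affRep] at h1 h2
    simp [← h2] at h1
  · have h2 := congrFun h 2
    simp [affRep] at h2
  · have h0 := congrFun h 0
    have h1 := congrFun h 1
    have h2 := congrFun h 2
    simp [affRep] at h0 h1 h2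
    subst h2
    simp at h0 h1
    subst h0 h1
    rfl

theorem exists_affRep (hΔ : W.Δ ≠ 0) {v : Fin 3 → F} (hv : v ≠ 0) (h : cub W v = 0) :
    ∃ (P : W.toAffine.Point) (e : F), e ≠ 0 ∧ v = e • affRep P := by
  by_cases hz : v 2 = 0
  · have hx := WeierstrassCurve.Projective.X_eq_zero_of_Z_eq_zero (equation_iff_cub.2 h) hz
    have hy : v 1 ≠ 0 := fun hy => hv (by ext i; fin_cases i <;> assumption)
    refine ⟨0, v 1, hy, ?_⟩
    ext i
    fin_cases i <;> simp [hx, hz]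
  · have h' := equation_iff_cub.2 h
    rw [WeierstrassCurve.Projective.equation_of_Z_ne_zero hz,
      WeierstrassCurve.Affine.equation_iff_nonsingular_of_Δ_ne_zero hΔ] at h'
    refine ⟨.some _ _ h', v 2, hz, ?_⟩
    ext i
    fin_cases i
    · simp [mul_div_cancel₀ _ hz]
    · simp [mul_div_cancel₀ _ hz]
    · simp

theorem vCut_vertical {x y : F} (h : W.toAffine.Equation x y) :
    VCut W ![0, 1, 0] ![x, y, 1] ![x, W.toAffine.negY x y, 1] := by
  rw [WeierstrassCurve.Affine.equation_iff] at h
  refine ⟨![0, 1, 0], ![x, 0, 1], 1, 0, y, 1, W.toAffine.negY x y, 1, -1, by simp,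
    isPrimitive_of_isUnit 0 (by simp [cross_apply]), ?_, ?_, ?_, ?_, ?_, ?_, ?_⟩
  · simp
  · simp
  · simp
  · simp [cub]
  · simp [pol, grad]
  · simp [pol, grad, WeierstrassCurve.Affine.negY]
    ring
  · simp [cub, WeierstrassCurve.Affine.negY]
    linear_combination h

/-- The line at infinity z = 0 meets the cubic only in the flex [0 : 1 : 0], with multiplicity
three. -/
theorem vCut_infinity : VCut W ![0, 1, 0] ![0, 1, 0] ![0, 1, 0] := by
  refine ⟨![1, 0, 0], ![0, 1, 0], 0, 1, 0, 1, 0, 1, -1, by simp,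
    isPrimitive_of_isUnit 2 (by simp [cross_apply]), ?_, ?_, ?_, ?_, ?_, ?_, ?_⟩ <;>
  simp [cub, pol, grad]

variable [DecidableEq F]

theorem vCut_slope {x₁ x₂ y₁ y₂ : F} (h₁ : W.toAffine.Equation x₁ y₁)
    (h₂ : W.toAffine.Equation x₂ y₂) (hxy : ¬(x₁ = x₂ ∧ y₁ = W.toAffine.negY x₂ y₂)) :
    VCut W ![x₁, y₁, 1] ![x₂, y₂, 1]
      ![W.toAffine.addX x₁ x₂ (W.toAffine.slope x₁ x₂ y₁ y₂),
        W.toAffine.negAddY x₁ x₂ y₁ (W.toAffine.slope x₁ x₂ y₁ y₂), 1] := by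
  have hp := WeierstrassCurve.Affine.addPolynomial_slope h₁ h₂ hxy
  have hy2 : y₂ = W.toAffine.slope x₁ x₂ y₁ y₂ * (x₂ - x₁) + y₁ := by
    by_cases hx : x₁ = x₂
    · have := WeierstrassCurve.Affine.Y_eq_of_Y_ne h₁ h₂ hx (fun h => hxy ⟨hx, h⟩)
      rw [hx, this]
      ring
    · rw [WeierstrassCurve.Affine.slope_of_X_ne hx]
      field_simp [sub_ne_zero.2 hx]
      ring
  rw [WeierstrassCurve.Affine.addPolynomial_eq] at hp
  generalize W.toAffine.slope x₁ x₂ y₁ y₂ = l at *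
  rw [neg_inj, Cubic.prod_X_sub_C_eq, Cubic.toPoly_injective] at hp
  simp only [Cubic.mk.injEq, true_and] at hp
  obtain ⟨hb, hc, hd⟩ := hp
  rw [WeierstrassCurve.Affine.negAddY]
  generalize W.toAffine.addX x₁ x₂ l = x₃ at *
  -- The line y = l x + (y₁ - l x₁) is spanned by its point at infinity and its intercept, so a
  -- point with abscissa x has parameters (x, 1).
  refine ⟨![1, l, 0], ![0, y₁ - l * x₁, 1], x₁, 1, x₂, 1, x₃, 1, -1, by simp,
    isPrimitive_of_isUnit 1 (by simp [cross_apply]), ?_, ?_, ?_, ?_, ?_, ?_, ?_⟩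
  · simp; ring
  · simp [hy2]; ring
  · simp; ring
  · simp [cub]
  · simp [pol, grad]
    linear_combination -hb
  · simp [pol, grad]
    linear_combination -hc
  · simp [cub]
    linear_combination -hd

/-- The scalar `e` is needed because negation sends the vector (0, 1, 0) to (0, -1, 0). -/
theorem vCut_add (P Q : W.toAffine.Point) :
    ∃ e : F, e ≠ 0 ∧ VCut W (affRep P) (affRep Q) (e • W.toProjective.neg (affRep (P + Q))) := by
  obtain ⟨e, he, h⟩ := affRep_neg (P + Q)
  refine ⟨e, he, ?_⟩
  rw [← h]
  clear h he e
  rcases P with _ | ⟨x₁, y₁, h₁⟩ <;> rcases Q with _ | ⟨x₂, y₂, h₂⟩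
  · exact vCut_infinity
  · rw [← WeierstrassCurve.Affine.Point.zero_def, zero_add]
    exact vCut_vertical h₂.1
  · rw [← WeierstrassCurve.Affine.Point.zero_def, add_zero]
    exact (vCut_vertical h₁.1).swap
  · by_cases hxy : x₁ = x₂ ∧ y₁ = W.toAffine.negY x₂ y₂
    · obtain ⟨rfl, rfl⟩ := hxy
      rw [WeierstrassCurve.Affine.Point.add_of_Y_eq rfl rfl, neg_zero, affRep_zero]
      -- Opposite points: the vertical line again, with the point at infinity as third point.
      obtain ⟨A, B, p₁, p₂, q₁, q₂, t₁, t₂, c, hc, hAB, hu, hv, hw, h0, h1, h2, h3⟩ :=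
        vCut_vertical h₂.1
      refine ⟨A, B, t₁, t₂, q₁, q₂, p₁, p₂, c, hc, hAB, hw, hv, hu, ?_, ?_, ?_, ?_⟩
      · rw [h0]; ring
      · rw [h1]; ring
      · rw [h2]; ring
      · rw [h3]; ring
    · rw [WeierstrassCurve.Affine.Point.add_some hxy, WeierstrassCurve.Affine.Point.neg_some]
      simp only [affRep_some, WeierstrassCurve.Affine.addY, WeierstrassCurve.Affine.negY_negY]
      exact vCut_slope h₁.1 h₂.1 hxy

end Field

/-! ### Nonvanishing of a Weierstrass cubic on lines -/

section NoLine

variable {F : Type*} [Field F] {W : WeierstrassCurve F}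

/-- A product of nonzero linear forms is nonzero. Over the residue field this is the core of Gauss's
lemma in `VCut.descend`. -/
theorem binaryForm_ne_zero {p₁ p₂ q₁ q₂ t₁ t₂ : F} (hp : p₁ ≠ 0 ∨ p₂ ≠ 0) (hq : q₁ ≠ 0 ∨ q₂ ≠ 0)
    (ht : t₁ ≠ 0 ∨ t₂ ≠ 0) : p₂ * q₂ * t₂ ≠ 0 ∨ p₁ * q₂ * t₂ + p₂ * q₁ * t₂ + p₂ * q₂ * t₁ ≠ 0 ∨
      p₁ * q₁ * t₂ + p₁ * q₂ * t₁ + p₂ * q₁ * t₁ ≠ 0 ∨ p₁ * q₁ * t₁ ≠ 0 := by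
  by_cases h2 : p₂ = 0
  · subst h2
    by_cases h3 : q₂ = 0
    · subst h3
      by_cases h4 : t₂ = 0 <;> simp_all
    · by_cases h4 : t₂ = 0 <;> simp_all
  · by_cases h3 : q₂ = 0
    · subst h3
      by_cases h4 : t₂ = 0 <;> simp_all
    · by_cases h4 : t₂ = 0 <;> simp_all

/-- A Weierstrass cubic contains no line. -/
theorem line_not_subset {A B : Fin 3 → F} (h : crossProduct A B ≠ 0) :
    cub W A ≠ 0 ∨ pol W A B ≠ 0 ∨ pol W B A ≠ 0 ∨ cub W B ≠ 0 := by
  by_contra! hc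
  obtain ⟨h0, h1, h2, h3⟩ := hc
  have hlin (s t : F) : cub W (s • A + t • B) = 0 := by rw [cub_lin, h0, h1, h2, h3]; ring
  have hpol (s t s' t' : F) : pol W (s • A + t • B) (s' • A + t' • B) = 0 := by
    rw [pol_lin, h0, h1, h2, h3]; ring
  -- The combination B₂ A - A₂ B has z = 0, where the cubic is -x³; so its first coordinate vanishes
  -- too.
  have hv0 : B 2 * A 0 - A 2 * B 0 = 0 := by
    have := hlin (B 2) (-A 2)
    simp only [cub, Pi.add_apply, Pi.smul_apply, smul_eq_mul] at this
    refine pow_eq_zero_iff (n := 3) (by norm_num) |>.1 ?_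
    have hz : B 2 * A 2 + -A 2 * B 2 = 0 := by ring
    rw [hz] at this
    linear_combination -this
  have hgr (v : Fin 3 → F) (hv0 : v 0 = 0) (hv2 : v 2 = 0) (s : Fin 3 → F) :
      pol W v s = v 1 ^ 2 * s 2 := by
    simp [pol, grad, hv0, hv2]
  have hvA := hpol (B 2) (-A 2) 1 0
  have hvB := hpol (B 2) (-A 2) 0 1
  rw [hgr _ (by simp; linear_combination hv0) (by simp; ring)] at hvA hvB
  simp only [Pi.add_apply, Pi.smul_apply, smul_eq_mul, one_mul, zero_mul, add_zero, zero_add]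
    at hvA hvB
  -- If this combination is the zero vector, the line is z = 0, on which the cubic is -x³ and not
  -- identically zero. Otherwise its gradient is a nonzero multiple of z, so the line is again z =
  -- 0, and the combination was zero after all.
  by_cases hz : B 2 * A 1 + -A 2 * B 1 = 0
  · have hz' : A 1 * B 2 - A 2 * B 1 = 0 := by linear_combination hz
    have h01 : A 0 * B 1 - A 1 * B 0 ≠ 0 := by
      intro h01
      refine h ?_
      ext i
      fin_cases i <;> simp [cross_apply]
      · exact hz'
      · linear_combination -hv0
      · exact h01
    have hA2 : A 2 = 0 := by
      refine (mul_eq_zero.1 (?_ : (A 0 * B 1 - A 1 * B 0) * A 2 = 0)).resolve_left h01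
      linear_combination A 1 * hv0 - A 0 * hz'
    have hB2 : B 2 = 0 := by
      refine (mul_eq_zero.1 (?_ : (A 0 * B 1 - A 1 * B 0) * B 2 = 0)).resolve_left h01
      linear_combination B 1 * hv0 - B 0 * hz'
    have hA0 : A 0 = 0 := by
      simp [cub, hA2] at h0
      exact h0
    have hB0 : B 0 = 0 := by
      simp [cub, hB2] at h3
      exact h3
    exact h01 (by rw [hA0, hB0]; ring)
  · have hA2 : A 2 = 0 := (mul_eq_zero.1 hvA).resolve_left (pow_ne_zero 2 hz)
    have hB2 : B 2 = 0 := (mul_eq_zero.1 hvB).resolve_left (pow_ne_zero 2 hz)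
    exact hz (by rw [hA2, hB2]; ring)

end NoLine

/-! ### Descent of lines from the fraction field of a valuation ring -/

section Descent

variable {O K : Type*} [CommRing O] [IsDomain O] [ValuationRing O] [Field K] [Algebra O K]
  [IsFractionRing O K] {W : WeierstrassCurve O}

/-- Divide by a coordinate of greatest valuation: it becomes 1 and the others become integral. -/
theorem exists_primitive_scaling {v : Fin 3 → K} (hv : v ≠ 0) :
    ∃ (a : K) (v' : Fin 3 → O), a ≠ 0 ∧ IsPrimitive v' ∧ v = a • (algebraMap O K ∘ v') := by
  obtain ⟨i, hi⟩ := Finite.exists_max fun j => ValuationRing.valuation O K (v j)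
  have hvi : v i ≠ 0 := by
    intro h0
    apply hv
    ext j
    have := hi j
    rw [h0, map_zero, le_zero_iff, map_eq_zero] at this
    exact this
  have hint (j : Fin 3) : ∃ a : O, algebraMap O K a = v j / v i := by
    have := (ValuationRing.mem_integer_iff O K (v j / v i)).1 (by
      rw [Valuation.mem_integer_iff, map_div₀]
      exact div_le_one_of_le₀ (hi j) zero_le)
    exact this
  choose v' hv' using hint
  refine ⟨v i, v', hvi, isPrimitive_of_isUnit i ?_, ?_⟩
  · have : v' i = 1 := by
      apply IsFractionRing.injective O K
      rw [hv', div_self hvi, map_one]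
    rw [this]
    exact isUnit_one
  · ext j
    simp [hv', mul_div_cancel₀ _ hvi]

/-- Row reduction: `A'` has a unit coordinate `i`, and clearing that coordinate in `B` before
rescaling gives `B'` a unit coordinate j ≠ i. The minor on `i`, `j` is then a unit. -/
theorem exists_primitive_line {A B : Fin 3 → K} (h : crossProduct A B ≠ 0) :
    ∃ (A' B' : Fin 3 → O) (α γ δ : K), α ≠ 0 ∧ δ ≠ 0 ∧ IsPrimitive (crossProduct A' B') ∧
      A = α • (algebraMap O K ∘ A') ∧
      B = γ • (algebraMap O K ∘ A') + δ • (algebraMap O K ∘ B') := by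
  have hA : A ≠ 0 := by
    rintro rfl
    simp at h
  obtain ⟨α, A', hα, hA', rfl⟩ := exists_primitive_scaling (O := O) hA
  obtain ⟨i, hi⟩ := hA'.exists_isUnit
  have hi0 : algebraMap O K (A' i) ≠ 0 := (hi.map _).ne_zero
  have hB : B - (B i / algebraMap O K (A' i)) • (algebraMap O K ∘ A') ≠ 0 := by
    intro h0
    rw [sub_eq_zero] at h0
    rw [h0] at h
    simp at h
  obtain ⟨δ, B', hδ, hB', hBB⟩ := exists_primitive_scaling (O := O) hB
  have hB'i : B' i = 0 := by
    have := congrFun hBB i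
    simp [div_mul_cancel₀ _ hi0] at this
    exact this.resolve_left hδ
  obtain ⟨j, hj⟩ := hB'.exists_isUnit
  refine ⟨A', B', α, B i / algebraMap O K (A' i), δ, hα, hδ, ?_, rfl, ?_⟩
  · have hu := hi.mul hj
    have key : ∃ k, crossProduct A' B' k = A' i * B' j ∨ crossProduct A' B' k = -(A' i * B' j) := by
      fin_cases i <;> fin_cases j <;> simp at hB'i hj <;>
        first
        | exact absurd hj (by rw [hB'i]; exact not_isUnit_zero)
        | (refine ⟨0, ?_⟩; simp [cross_apply, hB'i]; done)
        | (refine ⟨1, ?_⟩; simp [cross_apply, hB'i]; done)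
        | (refine ⟨2, ?_⟩; simp [cross_apply, hB'i])
    obtain ⟨k, hk | hk⟩ := key
    · exact isPrimitive_of_isUnit k (hk ▸ hu)
    · exact isPrimitive_of_isUnit k (hk ▸ hu.neg)
  · rw [← hBB]
    abel

/-- Cramer's rule with a unit minor makes the parameters integral; primitivity of `u` keeps them
from both lying in the maximal ideal. -/
theorem exists_integral_params {A B u : Fin 3 → O} (hn : IsPrimitive (crossProduct A B))
    (hu : IsPrimitive u) {p₁ p₂ : K} (h : algebraMap O K ∘ u =
      p₁ • (algebraMap O K ∘ A) + p₂ • (algebraMap O K ∘ B)) :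
    ∃ r₁ r₂ : O, p₁ = algebraMap O K r₁ ∧ p₂ = algebraMap O K r₂ ∧ u = r₁ • A + r₂ • B ∧
      (IsUnit r₁ ∨ IsUnit r₂) := by
  obtain ⟨k, hk⟩ := hn.exists_isUnit
  obtain ⟨n, hn⟩ := hk.exists_right_inv
  have hk' := congrArg (algebraMap O K) hn
  rw [map_mul, map_one] at hk'
  have h0 := congrFun h 0
  have h1 := congrFun h 1
  have h2 := congrFun h 2
  simp only [Function.comp_apply, Pi.add_apply, Pi.smul_apply, smul_eq_mul] at h0 h1 h2
  have hcross : algebraMap O K (crossProduct u B k) = p₁ * algebraMap O K (crossProduct A B k) ∧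
      algebraMap O K (crossProduct A u k) = p₂ * algebraMap O K (crossProduct A B k) := by
    fin_cases k <;> simp [cross_apply, h0, h1, h2] <;> constructor <;> ring
  have e1 : p₁ = algebraMap O K (crossProduct u B k * n) := by
    rw [map_mul, hcross.1, mul_assoc, hk', mul_one]
  have e2 : p₂ = algebraMap O K (crossProduct A u k * n) := by
    rw [map_mul, hcross.2, mul_assoc, hk', mul_one]
  have hlin : u = (crossProduct u B k * n) • A + (crossProduct A u k * n) • B := by
    ext i
    apply IsFractionRing.injective O K
    have := congrFun h i
    simp only [Function.comp_apply, Pi.add_apply, Pi.smul_apply, smul_eq_mul] at this ⊢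
    rw [this, map_add, map_mul, map_mul _ _ (B i), ← e1, ← e2]
  refine ⟨_, _, e1, e2, hlin, ?_⟩
  obtain ⟨j, hj⟩ := hu.exists_isUnit
  have hj' := congrFun hlin j
  simp only [Pi.add_apply, Pi.smul_apply, smul_eq_mul] at hj'
  rw [hj'] at hj
  exact (IsLocalRing.isUnit_or_isUnit_of_isUnit_add hj).imp isUnit_of_mul_isUnit_left
    isUnit_of_mul_isUnit_left

/-- With a primitive basis of the line, the three points have primitive integral parameters. Gauss's
lemma makes the constant integral, and it is a unit because the reduced cubic contains no line. -/
theorem VCut.descend {u v w : Fin 3 → O} (hu : IsPrimitive u) (hv : IsPrimitive v)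
    (hw : IsPrimitive w) (h : VCut (W.map (algebraMap O K)) (algebraMap O K ∘ u)
      (algebraMap O K ∘ v) (algebraMap O K ∘ w)) : VCut W u v w := by
  obtain ⟨A, B, p₁, p₂, q₁, q₂, t₁, t₂, c, hc, hAB, hpu, hqv, htw, hd⟩ := h
  obtain ⟨A', B', α, γ, δ, hα, hδ, hn, hA, hB⟩ := exists_primitive_line (O := O) hAB.ne_zero
  have hd' := hd.reparam α 0 γ δ (α * δ)⁻¹
  have hA' : ((α * δ)⁻¹ * δ) • A + (-((α * δ)⁻¹ * 0)) • B = algebraMap O K ∘ A' := by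
    rw [hA]
    ext i
    simp
    field_simp
  have hB' : (-((α * δ)⁻¹ * γ)) • A + ((α * δ)⁻¹ * α) • B = algebraMap O K ∘ B' := by
    rw [hA, hB]
    ext i
    simp
    field_simp
    ring
  rw [hA', hB'] at hd'
  have hlin (s t : K) : s • A + t • B = (s * α + t * γ) • (algebraMap O K ∘ A') +
      (s * 0 + t * δ) • (algebraMap O K ∘ B') := by
    rw [hA, hB]
    ext i
    simp
    ring
  rw [hlin] at hpu hqv htw
  obtain ⟨p, p', hp1, hp2, hup, hpp⟩ := exists_integral_params hn hu hpu
  obtain ⟨q, q', hq1, hq2, hvq, hqq⟩ := exists_integral_params hn hv hqv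
  obtain ⟨t, t', ht1, ht2, hwt, htt⟩ := exists_integral_params hn hw htw
  rw [hp1, hp2, hq1, hq2, ht1, ht2] at hd'
  have hne : c * ((α * δ)⁻¹) ^ 3 ≠ 0 := by
    have := hc.ne_zero
    positivity
  generalize c * ((α * δ)⁻¹) ^ 3 = d at hd' hne
  obtain ⟨h0, h1, h2, h3⟩ := hd'
  rw [cub_map] at h0 h3
  rw [pol_map] at h1 h2
  have hres {x : O} (hx : IsUnit x) : IsLocalRing.residue O x ≠ 0 := (hx.map _).ne_zero
  -- Some coefficient of the product of linear forms is a unit, and dividing by it shows that `d` is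
  -- integral.
  have hgauss := binaryForm_ne_zero (hpp.imp hres hres) (hqq.imp hres hres) (htt.imp hres hres)
  simp only [← map_mul, ← map_add, IsLocalRing.residue_ne_zero_iff_isUnit] at hgauss
  have hd : ∃ e : O, d = algebraMap O K e := by
    have key {g f : O} (hg : IsUnit g) (h : algebraMap O K f = d * algebraMap O K g) :
        ∃ e : O, d = algebraMap O K e := by
      obtain ⟨x, hx⟩ := hg.exists_right_inv
      refine ⟨f * x, ?_⟩
      rw [map_mul, h, mul_assoc, ← map_mul, hx, map_one, mul_one]
    rcases hgauss with hg | hg | hg | hg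
    · exact key hg (h0.trans (by simp))
    · refine key (f := -pol W A' B') hg ?_
      rw [map_neg, h1]
      simp
    · exact key hg (h2.trans (by simp))
    · refine key (f := -cub W B') hg ?_
      rw [map_neg, h3]
      simp
  obtain ⟨e, rfl⟩ := hd
  simp only [← map_mul, ← map_add, ← map_neg] at h0 h1 h2 h3
  have hdO : LineData W A' B' p p' q q' t t' e :=
    ⟨IsFractionRing.injective O K h0, IsFractionRing.injective O K h1,
      IsFractionRing.injective O K h2, IsFractionRing.injective O K h3⟩
  refine ⟨A', B', p, p', q, q', t, t', e, ?_, hn, hup, hvq, hwt, hdO⟩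
  by_contra he
  have he0 : IsLocalRing.residue O e = 0 := by
    by_contra h
    exact he ((IsLocalRing.residue_ne_zero_iff_isUnit e).1 h)
  have hm := hdO.map (IsLocalRing.residue O)
  rw [he0] at hm
  obtain ⟨h0, h1, h2, h3⟩ := hm
  have hn' := (hn.map (IsLocalRing.residue O)).ne_zero
  rw [← map_crossProduct] at hn'
  rcases line_not_subset (W := W.map (IsLocalRing.residue O)) hn' with h | h | h | h
  · exact h (h0.trans (by ring))
  · exact h (h1.trans (by ring))
  · exact h (h2.trans (by ring))
  · exact h (h3.trans (by ring))

/-- Proportional primitive vectors differ by a unit. -/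
theorem exists_unit_of_proportional {u v : Fin 3 → O} (hu : IsPrimitive u) (hv : IsPrimitive v)
    {a : K} (h : algebraMap O K ∘ u = a • (algebraMap O K ∘ v)) :
    ∃ e : O, IsUnit e ∧ u = e • v := by
  obtain ⟨k, hk⟩ := hv.exists_isUnit
  obtain ⟨n, hn⟩ := hk.exists_right_inv
  have hk' := congrArg (algebraMap O K) hn
  rw [map_mul, map_one] at hk'
  have ha : a = algebraMap O K (u k * n) := by
    have := congrFun h k
    simp only [Function.comp_apply, Pi.smul_apply, smul_eq_mul] at this
    rw [map_mul, this, mul_assoc, hk', mul_one]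
  have huv : u = (u k * n) • v := by
    ext i
    apply IsFractionRing.injective O K
    have := congrFun h i
    simp only [Function.comp_apply, Pi.smul_apply, smul_eq_mul] at this ⊢
    rw [this, ha, ← map_mul]
  refine ⟨_, ?_, huv⟩
  obtain ⟨j, hj⟩ := hu.exists_isUnit
  rw [huv, Pi.smul_apply, smul_eq_mul] at hj
  exact isUnit_of_mul_isUnit_left hj

/-! ### The integral point attached to a point over the fraction field -/

theorem exists_integral_rep (P : (W.map (algebraMap O K)).toAffine.Point) :
    ∃ (v : Fin 3 → O) (a : K), a ≠ 0 ∧ IsPrimitive v ∧ cub W v = 0 ∧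
      affRep P = a • (algebraMap O K ∘ v) := by
  obtain ⟨a, v, ha, hv, h⟩ := exists_primitive_scaling (O := O) (isPrimitive_affRep P).ne_zero
  refine ⟨v, a, ha, hv, ?_, h⟩
  have := cub_affRep P
  rw [h, cub_smul, cub_map] at this
  exact IsFractionRing.injective O K
    (((mul_eq_zero.1 this).resolve_left (pow_ne_zero 3 ha)).trans (map_zero _).symm)

/-- The section over a valuation ring extending a point over its fraction field. -/
noncomputable def integralPoint (P : (W.map (algebraMap O K)).toAffine.Point) : Points W :=
  Points.ofRep (exists_integral_rep P).choose (exists_integral_rep P).choose_spec.choose_spec.2.1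
    (exists_integral_rep P).choose_spec.choose_spec.2.2.1

theorem exists_isRep_integralPoint (P : (W.map (algebraMap O K)).toAffine.Point) :
    ∃ (v : Fin 3 → O) (a : K), (integralPoint P).IsRep v ∧ a ≠ 0 ∧
      affRep P = a • (algebraMap O K ∘ v) :=
  ⟨_, _, rfl, (exists_integral_rep P).choose_spec.choose_spec.1,
    (exists_integral_rep P).choose_spec.choose_spec.2.2.2⟩

theorem integralPoint_eq {P : (W.map (algebraMap O K)).toAffine.Point} {Q : Points W}
    {w : Fin 3 → O} (hw : Q.IsRep w) {a : K}
    (h : algebraMap O K ∘ w = a • affRep P) : integralPoint P = Q := by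
  obtain ⟨v, b, hv, hb, hvP⟩ := exists_isRep_integralPoint P
  rw [hvP, smul_smul] at h
  obtain ⟨e, he, h⟩ := exists_unit_of_proportional hw.isPrimitive hv.isPrimitive h
  exact Points.eq_of_isRep hv hw he h

theorem integralPoint_zero : integralPoint (0 : (W.map (algebraMap O K)).toAffine.Point) = 0 := by
  refine integralPoint_eq (a := 1) Points.isRep_zero ?_
  ext i
  fin_cases i <;> simp

theorem integralPoint_neg (P : (W.map (algebraMap O K)).toAffine.Point) :
    integralPoint (-P) = -integralPoint P := by
  obtain ⟨v, a, hv, ha, hvP⟩ := exists_isRep_integralPoint P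
  obtain ⟨e, he, h⟩ := affRep_neg P
  refine integralPoint_eq (a := (e * a)⁻¹) hv.neg ?_
  rw [h, hvP, comp_neg, smul_smul]
  ext i
  fin_cases i <;> simp [neg_eq] <;> field_simp

theorem integralPoint_surjective (hΔ : IsUnit W.Δ) :
    Function.Surjective (integralPoint : (W.map (algebraMap O K)).toAffine.Point → Points W) := by
  intro Q
  obtain ⟨v, hv, hv', hc⟩ := Q.exists_isRep
  obtain ⟨P, e, he, h⟩ := exists_affRep (W := W.map (algebraMap O K)) (v := algebraMap O K ∘ v)
    (by rw [WeierstrassCurve.map_Δ]; exact (hΔ.map _).ne_zero) (hv'.map _).ne_zero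
    (by rw [cub_map, hc, map_zero])
  exact ⟨P, integralPoint_eq hv h⟩

theorem cutByLine_integralPoint [DecidableEq K] (P Q : (W.map (algebraMap O K)).toAffine.Point) :
    CutByLine (integralPoint P) (integralPoint Q) (-integralPoint (P + Q)) := by
  obtain ⟨u, a, hu, ha, huP⟩ := exists_isRep_integralPoint P
  obtain ⟨v, b, hv, hb, hvQ⟩ := exists_isRep_integralPoint Q
  obtain ⟨w, c, hw, hc, hwS⟩ := exists_isRep_integralPoint (P + Q)
  rw [cutByLine_iff hu hv hw.neg]
  refine VCut.descend (K := K) hu.isPrimitive hv.isPrimitive hw.neg.isPrimitive ?_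
  obtain ⟨e, he, h⟩ := vCut_add P Q
  have := h.smul (a := a⁻¹) (b := b⁻¹) (c := (e * c)⁻¹) (by simp [ha]) (by simp [hb])
    (by simp [he, hc])
  rw [huP, hvQ, hwS, smul_smul, smul_smul, inv_mul_cancel₀ ha, inv_mul_cancel₀ hb, one_smul,
    one_smul] at this
  convert! this using 1
  rw [comp_neg]
  ext i
  fin_cases i <;> simp [neg_eq] <;> field_simp

end Descent

/-! ### Additive maps from a group to a set with operations -/

section AdditiveKernel

variable {G X : Type*} [AddCommGroup G] [Add X] [Zero X] [Neg X] {ρ : G → X}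

/-- A map from a group to a type with an addition, zero and negation that respects them. -/
structure IsAdditive (ρ : G → X) : Prop where
  add : ∀ a b, ρ (a + b) = ρ a + ρ b
  zero : ρ 0 = 0
  neg : ∀ a, ρ (-a) = -ρ a

/-- The kernel of an additive map. -/
def IsAdditive.ker (h : IsAdditive ρ) : AddSubgroup G where
  carrier := {a | ρ a = 0}
  zero_mem' := h.zero
  add_mem' {a b} ha hb := by
    -- Nothing is known about the operations of `X`, so even 0 + 0 = 0 is obtained through `ρ`.
    have e : ρ (0 + 0) = 0 + 0 := by rw [h.add, h.zero]
    change ρ (a + b) = 0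
    rw [h.add, ha, hb, ← e, add_zero, h.zero]
  neg_mem' {a} ha := by
    change ρ (-a) = 0
    rw [h.neg, ha, ← h.zero, ← h.neg, neg_zero]

theorem IsAdditive.mem_ker (h : IsAdditive ρ) {a : G} : a ∈ h.ker ↔ ρ a = 0 := Iff.rfl

/-- The image of `ρ` behaves as the quotient of `G` by the kernel, although `X` is not known to be a
group. -/
theorem IsAdditive.eq_iff (h : IsAdditive ρ) {a b : G} : ρ a = ρ b ↔ a - b ∈ h.ker := by
  rw [h.mem_ker]
  constructor
  · intro hab
    rw [sub_eq_add_neg, h.add, h.neg, hab, ← h.neg, ← h.add, add_neg_cancel, h.zero]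
  · intro hab
    rw [← sub_add_cancel a b, h.add, hab, ← h.zero, ← h.add, zero_add]


end AdditiveKernel

/-! ### Evaluating the chord and tangent law -/

section Add

variable {R : Type*} [CommRing R] {W : WeierstrassCurve R}

theorem Points.add_eq_of_unique {P Q S : Points W} (h : CutByLine P Q (-S))
    (hu : ∀ S', CutByLine P Q (-S') → S' = S) : P + Q = S := by
  have hex : ∃ S : Points W, CutByLine P Q (-S) := ⟨S, h⟩
  have : P + Q = hex.choose := dif_pos hex
  rw [this]
  exact hu _ hex.choose_spec

theorem Points.add_eq [IsLocalRing R] (hΔ : IsUnit W.Δ) {P Q S : Points W}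
    (h : CutByLine P Q (-S)) : P + Q = S := by
  refine Points.add_eq_of_unique h fun S' h' => ?_
  rw [← Points.neg_neg S', CutByLine.unique hΔ h' h, Points.neg_neg]

end Add

/-! ### Points over a finite field -/

section Field

variable {F : Type*} [Field F] {W : WeierstrassCurve F}

/-- The projective point attached to an affine point or to infinity. -/
noncomputable def affPoint (P : W.toAffine.Point) : Points W :=
  Points.ofRep (affRep P) (isPrimitive_affRep P) (cub_affRep P)

theorem isRep_affPoint (P : W.toAffine.Point) : (affPoint P).IsRep (affRep P) := rfl

theorem affPoint_injective : Function.Injective (affPoint : W.toAffine.Point → Points W) := by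
  intro P Q h
  have hP := isRep_affPoint P
  rw [h, Points.isRep_iff (isRep_affPoint Q)] at hP
  obtain ⟨e, -, he⟩ := hP
  exact affRep_injective he

theorem affPoint_surjective (hΔ : W.Δ ≠ 0) :
    Function.Surjective (affPoint : W.toAffine.Point → Points W) := by
  intro Q
  obtain ⟨v, hv, hv', hc⟩ := Q.exists_isRep
  obtain ⟨P, e, he, h⟩ := exists_affRep hΔ hv'.ne_zero hc
  exact ⟨P, Points.eq_of_isRep (isRep_affPoint P) hv he.isUnit h⟩

theorem affPoint_add [DecidableEq F] (hΔ : W.Δ ≠ 0) (P Q : W.toAffine.Point) :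
    affPoint (P + Q) = affPoint P + affPoint Q := by
  refine (Points.add_eq hΔ.isUnit ?_).symm
  obtain ⟨e, he, h⟩ := vCut_add P Q
  rw [cutByLine_iff (isRep_affPoint P) (isRep_affPoint Q) (isRep_affPoint (P + Q)).neg]
  have := h.smul (a := 1) (b := 1) (c := e⁻¹) isUnit_one isUnit_one (by simpa using he)
  rwa [one_smul, one_smul, smul_smul, inv_mul_cancel₀ he, one_smul] at this

end Field

/-! ### Reduction of `p`-adic points -/

section Local

theorem isUnit_of_map_eq_one {R S : Type*} [CommRing R] [CommRing S] [IsLocalRing R] [Nontrivial S]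
    (f : R →+* S) {x : R} (h : f x = 1) : IsUnit x := by
  refine (IsLocalRing.isUnit_or_isUnit_one_sub_self x).resolve_right fun h' => ?_
  have := h'.map f
  rw [map_sub, map_one, h, sub_self] at this
  exact not_isUnit_zero this

theorem isUnit_of_isUnit_map {R S : Type*} [CommRing R] [CommRing S] [IsLocalRing R] [Nontrivial S]
    {f : R →+* S} (hf : Function.Surjective f) {x : R} (h : IsUnit (f x)) : IsUnit x := by
  obtain ⟨y, hy⟩ := h.exists_right_inv
  obtain ⟨y, rfl⟩ := hf y
  rw [← map_mul] at hy
  exact isUnit_of_mul_isUnit_left (isUnit_of_map_eq_one f hy)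

end Local

section Padic

variable {p : ℕ} [Fact p.Prime] {R : Type*} [CommRing R] {f : ℤ_[p] →+* R}

/-- Hensel's lemma at 0. It gives only a root in the maximal ideal; writing the equation as a unit
times T equal to -c₀ puts T in the kernel of `f`. -/
theorem hensel_cubic [Nontrivial R] {c₀ c₁ c₂ c₃ : ℤ_[p]} (h0 : f c₀ = 0) (h1 : IsUnit c₁) :
    ∃ T, f T = 0 ∧ c₀ + c₁ * T + c₂ * T ^ 2 + c₃ * T ^ 3 = 0 := by
  let g : Polynomial ℤ_[p] := .C c₀ + .C c₁ * .X + .C c₂ * .X ^ 2 + .C c₃ * .X ^ 3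
  have hg (T : ℤ_[p]) : g.aeval T = c₀ + c₁ * T + c₂ * T ^ 2 + c₃ * T ^ 3 := by
    simp [g]
  have hg' : g.derivative.aeval (0 : ℤ_[p]) = c₁ := by
    simp [g]
  have hc0 : ‖c₀‖ < 1 := by
    rw [← PadicInt.not_isUnit_iff]
    intro hu
    have := hu.map f
    rw [h0] at this
    exact not_isUnit_zero this
  obtain ⟨T, hT, hT', -⟩ := hensels_lemma (F := g) (a := (0 : ℤ_[p])) (by
    rw [hg', hg, PadicInt.isUnit_iff.1 h1]
    simpa using hc0)
  rw [hg] at hT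
  rw [hg', PadicInt.isUnit_iff.1 h1, sub_zero] at hT'
  refine ⟨T, ?_, hT⟩
  have hu : IsUnit (c₁ + T * (c₂ + c₃ * T)) := by
    by_contra hu
    have hT : ¬ IsUnit T := PadicInt.not_isUnit_iff.2 hT'
    have hm : c₁ = (c₁ + T * (c₂ + c₃ * T)) - (c₂ + c₃ * T) * T := by ring
    have : c₁ ∈ IsLocalRing.maximalIdeal ℤ_[p] := by
      rw [hm]
      exact sub_mem hu (Ideal.mul_mem_left _ _ hT)
    exact this h1
  have := congrArg f (show (c₁ + T * (c₂ + c₃ * T)) * T = -c₀ by linear_combination hT)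
  rw [map_mul, map_neg, h0, neg_zero] at this
  exact (hu.map f).mul_right_eq_zero.1 this

variable {W : WeierstrassCurve ℤ_[p]} {W' : WeierstrassCurve R} (hW : W.map f = W')

theorem Points.map_surjective_padic [Nontrivial R] (hf : Function.Surjective f) (hΔ : IsUnit W.Δ) :
    Function.Surjective (Points.map f hW : Points W → Points W') := by
  subst hW
  have _ : IsLocalRing R := IsLocalRing.of_surjective' f hf
  intro P
  obtain ⟨v, hv, hv', hc⟩ := P.exists_isRep
  obtain ⟨w, rfl⟩ : ∃ w : Fin 3 → ℤ_[p], f ∘ w = v :=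
    ⟨fun i => (hf (v i)).choose, funext fun i => (hf (v i)).choose_spec⟩
  -- An arbitrary lift of the coordinates is corrected along a direction `e_k` in which the
  -- derivative is a unit, without changing its image under `f`.
  obtain ⟨k, hk⟩ := exists_isUnit_grad (W := W.map f)
    (by rw [WeierstrassCurve.map_Δ]; exact hΔ.map f) hv' hc
  rw [grad_map] at hk
  have hk' : IsUnit (pol W w (Pi.single k 1)) := by
    have := isUnit_of_isUnit_map hf hk
    convert! this using 1
    fin_cases k <;> simp [pol]
  rw [cub_map] at hc
  obtain ⟨T, hT, hT'⟩ := hensel_cubic (c₂ := pol W (Pi.single k 1) w)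
    (c₃ := cub W (Pi.single k 1)) hc hk'
  have hred : f ∘ ((1 : ℤ_[p]) • w + T • Pi.single k 1) = f ∘ w := by
    rw [comp_smul_add_smul, hT]
    simp
  have hc' : cub W ((1 : ℤ_[p]) • w + T • Pi.single k 1) = 0 := by
    rw [cub_lin]
    linear_combination hT'
  have hp : IsPrimitive ((1 : ℤ_[p]) • w + T • Pi.single k 1) := by
    rw [← hred] at hv'
    obtain ⟨j, hj⟩ := hv'.exists_isUnit
    exact isPrimitive_of_isUnit j (isUnit_of_isUnit_map hf hj)
  refine ⟨Points.ofRep _ hp hc',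
    Points.eq_of_isRep ((Points.isRep_ofRep _ hp hc').map f rfl) hv isUnit_one ?_⟩
  rw [hred, one_smul]

/-- Reduction of a `p`-adic point along a ring homomorphism from `ℤ_[p]`. -/
noncomputable def reduce (P : (W.map (algebraMap ℤ_[p] ℚ_[p])).toAffine.Point) : Points W' :=
  (integralPoint P).map f hW

theorem cutByLine_reduce [DecidableEq ℚ_[p]] (P Q : (W.map (algebraMap ℤ_[p] ℚ_[p])).toAffine.Point) :
    CutByLine (reduce hW P) (reduce hW Q) (-reduce hW (P + Q)) := by
  rw [reduce, reduce, reduce, ← Points.map_neg]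
  exact (cutByLine_integralPoint P Q).map f hW

theorem isAdditive_reduce [Nontrivial R] [DecidableEq ℚ_[p]] (hf : Function.Surjective f) (hΔ : IsUnit W.Δ) :
    IsAdditive (reduce hW) where
  add P Q := by
    have _ : IsLocalRing R := IsLocalRing.of_surjective' f hf
    refine (Points.add_eq ?_ (cutByLine_reduce hW P Q)).symm
    rw [← hW, WeierstrassCurve.map_Δ]
    exact hΔ.map f
  zero := by rw [reduce, integralPoint_zero, Points.map_zero]
  neg P := by rw [reduce, integralPoint_neg, Points.map_neg, reduce]

theorem reduce_surjective [Nontrivial R] (hf : Function.Surjective f) (hΔ : IsUnit W.Δ) :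
    Function.Surjective (reduce hW) :=
  (Points.map_surjective_padic hW hf hΔ).comp (integralPoint_surjective hΔ)

end Padic

/-! ### Kernels of the reduction maps -/

section Kernel

variable {p : ℕ} [Fact p.Prime] {R S : Type*} [CommRing R] [CommRing S]
  {f : ℤ_[p] →+* R} {g : R →+* S} {W : WeierstrassCurve ℤ_[p]} {W' : WeierstrassCurve R}
  {W'' : WeierstrassCurve S}

theorem isRep_reduce {f : ℤ_[p] →+* R} (hW : W.map f = W')
    {P : (W.map (algebraMap ℤ_[p] ℚ_[p])).toAffine.Point} {v : Fin 3 → ℤ_[p]}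
    (hv : (integralPoint P).IsRep v) : (reduce hW P).IsRep (f ∘ v) :=
  hv.map f hW

theorem reduce_comp (hW : W.map f = W') (hg : W'.map g = W'') (hW' : W.map (g.comp f) = W'')
    (P : (W.map (algebraMap ℤ_[p] ℚ_[p])).toAffine.Point) :
    (reduce hW P).map g hg = reduce hW' P :=
  Points.map_map f g hW hg hW' _

theorem exists_isRep_of_reduce_eq_zero [Nontrivial S] {f : ℤ_[p] →+* S} (hf : Function.Surjective f)
    (hW : W.map f = W'') {P : (W.map (algebraMap ℤ_[p] ℚ_[p])).toAffine.Point}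
    (hP : reduce hW P = 0) :
    ∃ x z : ℤ_[p], (integralPoint P).IsRep ![x, 1, z] ∧ f x = 0 ∧ f z = 0 := by
  obtain ⟨v, a, hv, -⟩ := exists_isRep_integralPoint P
  have h := isRep_reduce hW hv
  rw [hP, Points.isRep_iff Points.isRep_zero] at h
  obtain ⟨e, he, h⟩ := h
  have h0 := congrFun h 0
  have h1 := congrFun h 1
  have h2 := congrFun h 2
  simp at h0 h1 h2
  have hu : IsUnit (v 1) := isUnit_of_isUnit_map hf (h1 ▸ he)
  obtain ⟨u, hu'⟩ := hu.exists_left_inv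
  refine ⟨u * v 0, u * v 2, (Points.isRep_iff hv).2 ⟨u, .of_mul_eq_one _ hu', ?_⟩,
    by simp [h0], by simp [h2]⟩
  ext i
  fin_cases i <;> simp [hu']

/-- Near the point at infinity, a point of the cubic is determined by its first coordinate. -/
theorem eq_of_cub_eq_zero [Nontrivial S] [IsLocalRing R] {x z z' : R} (hx : g x = 0) (hz : g z = 0)
    (hz' : g z' = 0) (h : cub W' ![x, 1, z] = 0) (h' : cub W' ![x, 1, z'] = 0) : z = z' := by
  have hu : IsUnit (1 + W'.a₁ * x + W'.a₃ * (z + z') - (W'.a₂ * x ^ 2 + W'.a₄ * x * (z + z') +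
      W'.a₆ * (z ^ 2 + z * z' + z' ^ 2))) := by
    refine isUnit_of_map_eq_one g ?_
    simp [hx, hz, hz']
  rw [← sub_eq_zero, ← hu.mul_right_eq_zero]
  simp [cub] at h h'
  linear_combination h - h'

/-- Points reducing to 𝒪 have coordinates [x : 1 : z], and modulo the smaller kernel such a point is
determined by the image of x in `R`. This gives a bijection of the quotient with the kernel of `g`;
it need not be a homomorphism, as only the cardinality matters. -/
theorem relIndex_ker_reduce [Nontrivial S] [Nontrivial R] [DecidableEq ℚ_[p]] (hf : Function.Surjective f)
    (hg : Function.Surjective g) (hΔ : IsUnit W.Δ) (hW : W.map f = W')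
    (hW' : W.map (g.comp f) = W'') :
    (isAdditive_reduce hW hf hΔ).ker ≤ (isAdditive_reduce hW' (hg.comp hf) hΔ).ker ∧
    (isAdditive_reduce hW hf hΔ).ker.relIndex (isAdditive_reduce hW' (hg.comp hf) hΔ).ker =
      Nat.card (RingHom.ker g) := by
  have hgf : Function.Surjective (g.comp f) := hg.comp hf
  have _ : IsLocalRing R := IsLocalRing.of_surjective' f hf
  set K := (isAdditive_reduce hW hf hΔ).ker with hK
  set L := (isAdditive_reduce hW' hgf hΔ).ker with hL
  have hW'' : W'.map g = W'' := by rw [← hW', ← hW, WeierstrassCurve.map_map]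
  refine ⟨fun a ha => ?_, ?_⟩
  · rw [hL, IsAdditive.mem_ker, ← reduce_comp hW hW'' hW']
    rw [hK, IsAdditive.mem_ker] at ha
    rw [ha, Points.map_zero]
  have hrep (P : L) := exists_isRep_of_reduce_eq_zero hgf hW' P.2
  choose x z hxz hx hz using hrep
  have hred (P : L) : (reduce hW P.1).IsRep ![f (x P), 1, f (z P)] := by
    have := isRep_reduce hW (hxz P)
    convert! this using 1
    ext i
    fin_cases i <;> simp
  have heq (P Q : L) : f (x P) = f (x Q) ↔ P - Q ∈ K.addSubgroupOf L := by
    rw [AddSubgroup.mem_addSubgroupOf]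
    change _ ↔ (P : (W.map (algebraMap ℤ_[p] ℚ_[p])).toAffine.Point) - Q ∈ K
    rw [hK, ← IsAdditive.eq_iff]
    constructor
    · intro h
      have hzz := eq_of_cub_eq_zero (g := g) (W' := W') (hx P) (hz P) (hz Q) (hred P).cub_eq
        (by rw [h]; exact (hred Q).cub_eq)
      exact Points.eq_of_isRep (hred P) (hred Q) isUnit_one (by rw [one_smul, h, hzz])
    · intro h
      have h' := hred P
      rw [h, Points.isRep_iff (hred Q)] at h'
      obtain ⟨e, -, he⟩ := h'
      have h0 := congrFun he 0
      have h1 := congrFun he 1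
      simp at h0 h1
      rw [h0, ← h1, one_mul]
  rw [AddSubgroup.relIndex, AddSubgroup.index_eq_card]
  let φ (P : L) : RingHom.ker g := ⟨f (x P), hx P⟩
  have hφ (P Q : L) : φ P = φ Q ↔ P - Q ∈ K.addSubgroupOf L := by
    rw [← heq, Subtype.ext_iff]
  refine Nat.card_eq_of_bijective (Quotient.lift φ fun a b hab => ?_) ⟨?_, ?_⟩
  · rw [← Quotient.eq_iff_equiv, eq_comm] at hab
    exact (hφ a b).2 (QuotientAddGroup.eq_iff_sub_mem.1 hab.symm)
  · rintro ⟨a⟩ ⟨b⟩ hab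
    exact QuotientAddGroup.eq_iff_sub_mem.2 ((hφ a b).1 hab)
  · rintro ⟨r, hr⟩
    obtain ⟨s, rfl⟩ := hf r
    -- The cubic at [s : 1 : T], as a polynomial in T, has linear coefficient congruent to 1, so z =
    -- T exists by Hensel.
    obtain ⟨T, hT, hT'⟩ := hensel_cubic (f := g.comp f) (c₀ := -s ^ 3)
      (c₁ := 1 + W.a₁ * s - W.a₂ * s ^ 2) (c₂ := W.a₃ - W.a₄ * s) (c₃ := -W.a₆)
      (by
        have : g (f s) = 0 := hr
        simp [this])
      (by
        refine isUnit_of_map_eq_one (g.comp f) ?_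
        have : g (f s) = 0 := hr
        simp [this])
    have hc : cub W ![s, 1, T] = 0 := by
      simp [cub]
      linear_combination hT'
    have hp : IsPrimitive ![s, 1, T] := isPrimitive_of_isUnit 1 (by simp)
    obtain ⟨P, hP⟩ := integralPoint_surjective (K := ℚ_[p]) hΔ (Points.ofRep _ hp hc)
    have hPrep : (integralPoint P).IsRep ![s, 1, T] := hP ▸ Points.isRep_ofRep _ hp hc
    have hPL : P ∈ L := by
      rw [hL, IsAdditive.mem_ker]
      refine Points.eq_of_isRep (isRep_reduce hW' hPrep) Points.isRep_zero isUnit_one ?_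
      have h1 : g (f s) = 0 := hr
      have h2 : g (f T) = 0 := hT
      ext i
      fin_cases i <;> simp [h1, h2]
    refine ⟨QuotientAddGroup.mk (⟨P, hPL⟩ : L), ?_⟩
    refine Subtype.ext ?_
    change f (x ⟨P, hPL⟩) = f s
    obtain ⟨e, -, he⟩ := (Points.isRep_iff hPrep).1 (hxz ⟨P, hPL⟩)
    have h0 := congrFun he 0
    have h1 := congrFun he 1
    simp at h0 h1
    rw [h0, ← h1, one_mul]

end Kernel

/-! ### Counting points over the prime field -/

section FiniteField

variable {p : ℕ} [Fact p.Prime] {W : WeierstrassCurve (ZMod p)}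

theorem card_affPoint (hΔ : W.Δ ≠ 0) : Nat.card W.toAffine.Point = Nat.card (Points W) :=
  Nat.card_eq_of_bijective _ ⟨affPoint_injective, affPoint_surjective hΔ⟩

theorem affine_point_finite : Finite W.toAffine.Point := by
  refine Finite.of_injective (fun P => (affRep P)) fun P Q h => ?_
  exact affRep_injective (e := 1) (by rw [one_smul]; exact h)

/-- At most two points lie over each abscissa. This crude bound replaces Hasse's: it is below p² for
p ≥ 3, all that `prime_pow_mul_card_dvd` needs. -/
theorem card_affine_point_le : Nat.card W.toAffine.Point ≤ 2 * p + 1 := by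
  classical
  have _ := affine_point_finite (W := W)
  have _ := Fintype.ofFinite W.toAffine.Point
  have hp : p ≠ 0 := (Fact.out : p.Prime).ne_zero
  have _ : NeZero p := ⟨hp⟩
  let s : Finset W.toAffine.Point := Finset.univ.erase 0
  have hcard : s.card ≤ 2 * (s.image fun P => affRep P 0).card := by
    refine Finset.card_le_mul_card_image _ _ fun a ha => ?_
    obtain ⟨P, hP, rfl⟩ := Finset.mem_image.1 ha
    rcases P with _ | ⟨x, y, h⟩
    · simp [s, WeierstrassCurve.Affine.Point.zero_def] at hP
    · refine (Finset.card_le_card (t := {.some x y h, -.some x y h}) ?_).trans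
        (Finset.card_le_two)
      intro Q hQ
      rw [Finset.mem_filter] at hQ
      rcases Q with _ | ⟨x', y', h'⟩
      · simp [s, WeierstrassCurve.Affine.Point.zero_def] at hQ
      · have hx : x' = x := by simpa using hQ.2
        simpa using WeierstrassCurve.Affine.Point.X_eq_iff (h₁ := h') (h₂ := h) |>.1 hx
  have himg : (s.image fun P => affRep P 0).card ≤ p :=
    (Finset.card_le_univ _).trans (by rw [ZMod.card])
  have : Nat.card W.toAffine.Point = s.card + 1 := by
    rw [Nat.card_eq_fintype_card, ← Finset.card_univ, Finset.card_erase_add_one (Finset.mem_univ _)]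
  omega

/-- A point of order 2 satisfies 2y = -(a₁x + a₃), so its abscissa is a root of the 2-torsion cubic
and determines y, as 2 is invertible. -/
theorem ncard_addOrderOf_two_le (hp : p ≠ 2) :
    {P : W.toAffine.Point | addOrderOf P = 2}.ncard ≤ 3 := by
  classical
  have h2 : (2 : ZMod p) ≠ 0 := by
    intro h
    have h' : ((2 : ℕ) : ZMod p) = 0 := by exact_mod_cast h
    rw [ZMod.natCast_eq_zero_iff] at h'
    exact hp ((Nat.prime_dvd_prime_iff_eq Fact.out Nat.prime_two).1 h')
  let c : Polynomial (ZMod p) := W.twoTorsionPolynomial.toPoly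
  have hc : c ≠ 0 := by
    refine Cubic.ne_zero_of_a_ne_zero ?_
    have : (4 : ZMod p) = 2 * 2 := by norm_num
    simp [WeierstrassCurve.twoTorsionPolynomial, this, h2]
  have hle : (c.roots.toFinset : Set (ZMod p)).ncard ≤ 3 := by
    rw [Set.ncard_coe_finset]
    exact (Multiset.toFinset_card_le _).trans
      ((Polynomial.card_roots' _).trans Polynomial.natDegree_cubic_le)
  have hord (x y : ZMod p) (h : W.toAffine.Nonsingular x y)
      (ho : addOrderOf (WeierstrassCurve.Affine.Point.some x y h) = 2) :
      2 * y = -(W.a₁ * x + W.a₃) := by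
    have h0 : (WeierstrassCurve.Affine.Point.some x y h) + .some x y h = 0 := by
      rw [← two_nsmul, ← ho, addOrderOf_nsmul_eq_zero]
    rw [add_eq_zero_iff_eq_neg, WeierstrassCurve.Affine.Point.neg_some,
      WeierstrassCurve.Affine.Point.some.injEq] at h0
    have := h0.2
    rw [WeierstrassCurve.Affine.negY] at this
    linear_combination this
  refine (Set.ncard_le_ncard_of_injOn (fun P => affRep P 0) ?_ ?_ (Finset.finite_toSet _)).trans hle
  · rintro (_ | ⟨x, y, h⟩) ho
    · rw [Set.mem_ofPred_eq, ← WeierstrassCurve.Affine.Point.zero_def, addOrderOf_zero] at ho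
      norm_num at ho
    · have hy := hord x y h ho
      have he := (WeierstrassCurve.Affine.equation_iff _ _).1 h.1
      simp only [Finset.mem_coe, Multiset.mem_toFinset]
      rw [Polynomial.mem_roots hc]
      simp [c, Cubic.toPoly, WeierstrassCurve.twoTorsionPolynomial, WeierstrassCurve.b₂,
        WeierstrassCurve.b₄, WeierstrassCurve.b₆]
      linear_combination -4 * he + (2 * y + W.a₁ * x + W.a₃) * hy
  · rintro (_ | ⟨x, y, h⟩) ho (_ | ⟨x', y', h'⟩) ho' hxx
    · rfl
    · rw [Set.mem_ofPred_eq, ← WeierstrassCurve.Affine.Point.zero_def, addOrderOf_zero] at ho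
      norm_num at ho
    · rw [Set.mem_ofPred_eq, ← WeierstrassCurve.Affine.Point.zero_def, addOrderOf_zero] at ho'
      norm_num at ho'
    · have hx : x = x' := by simpa using hxx
      subst hx
      have hy : y = y' := mul_left_cancel₀ h2 ((hord x y h ho).trans (hord x y' h' ho').symm)
      subst hy
      rfl

end FiniteField

/-! ### Points over a product of rings -/

section Product

variable {R : Type*} [CommRing R] {ι : Type*} {S : ι → Type*} [∀ i, CommRing (S i)]
  {φ : ∀ i, R →+* S i}

theorem exists_lift_vec (hs : ∀ s : ∀ i, S i, ∃ x, ∀ i, φ i x = s i) (v : ∀ i, Fin 3 → S i) :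
    ∃ w : Fin 3 → R, ∀ i, φ i ∘ w = v i := by
  choose w hw using fun k : Fin 3 => hs fun i => v i k
  exact ⟨w, fun i => funext fun k => hw k i⟩

theorem isUnit_of_forall_map (hi : ∀ x y, (∀ i, φ i x = φ i y) → x = y)
    (hs : ∀ s : ∀ i, S i, ∃ x, ∀ i, φ i x = s i) {x : R} (h : ∀ i, IsUnit (φ i x)) :
    IsUnit x := by
  choose y hy using fun i => (h i).exists_right_inv
  obtain ⟨z, hz⟩ := hs y
  exact IsUnit.of_mul_eq_one z (hi _ _ fun i => by rw [map_mul, hz, hy, map_one])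

theorem isPrimitive_of_forall_map (hi : ∀ x y, (∀ i, φ i x = φ i y) → x = y)
    (hs : ∀ s : ∀ i, S i, ∃ x, ∀ i, φ i x = s i) {v : Fin 3 → R}
    (h : ∀ i, IsPrimitive (φ i ∘ v)) : IsPrimitive v := by
  choose a b c h using fun i => isPrimitive_iff.1 (h i)
  obtain ⟨a', ha⟩ := hs a
  obtain ⟨b', hb⟩ := hs b
  obtain ⟨c', hc⟩ := hs c
  refine isPrimitive_iff.2 ⟨a', b', c', hi _ _ fun i => ?_⟩
  have := h i
  simp only [Function.comp_apply] at this
  simp only [map_add, map_mul, ha, hb, hc, this, map_one]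

variable {W : WeierstrassCurve R} {W' : ∀ i, WeierstrassCurve (S i)}

/-- The unit scalars relating the coordinates in each factor glue to a single unit of `R`. -/
theorem Points.ext_of_map (hi : ∀ x y, (∀ i, φ i x = φ i y) → x = y)
    (hs : ∀ s : ∀ i, S i, ∃ x, ∀ i, φ i x = s i) (hW : ∀ i, W.map (φ i) = W' i) {P Q : Points W}
    (h : ∀ i, P.map (φ i) (hW i) = Q.map (φ i) (hW i)) : P = Q := by
  obtain ⟨u, hu, -⟩ := P.exists_isRep
  obtain ⟨v, hv, -⟩ := Q.exists_isRep
  have key (i : ι) : ∃ e : S i, IsUnit e ∧ φ i ∘ v = e • (φ i ∘ u) :=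
    (Points.isRep_iff (hu.map (φ i) (hW i))).1 (h i ▸ hv.map (φ i) (hW i))
  choose e he hev using key
  obtain ⟨e', he'⟩ := hs e
  refine Points.eq_of_isRep hu hv (e := e')
    (isUnit_of_forall_map hi hs fun i => by rw [he']; exact he i) ?_
  ext k
  refine hi _ _ fun i => ?_
  simpa [he'] using congrFun (hev i) k

theorem Points.exists_of_map (hi : ∀ x y, (∀ i, φ i x = φ i y) → x = y)
    (hs : ∀ s : ∀ i, S i, ∃ x, ∀ i, φ i x = s i) (hW : ∀ i, W.map (φ i) = W' i)
    (P : ∀ i, Points (W' i)) : ∃ Q : Points W, ∀ i, Q.map (φ i) (hW i) = P i := by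
  choose v hv hv' hc using fun i => (P i).exists_isRep
  obtain ⟨w, hw⟩ := exists_lift_vec hs v
  have hp : IsPrimitive w := isPrimitive_of_forall_map hi hs fun i => by rw [hw]; exact hv' i
  have hc : cub W w = 0 := hi _ _ fun i => by rw [← cub_map, hw, hW, hc, _root_.map_zero]
  refine ⟨Points.ofRep w hp hc, fun i => ?_⟩
  exact Points.eq_of_isRep ((Points.isRep_ofRep w hp hc).map (φ i) (hW i)) (hv i) isUnit_one
    (by rw [hw, one_smul])

theorem VCut.of_map (hi : ∀ x y, (∀ i, φ i x = φ i y) → x = y)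
    (hs : ∀ s : ∀ i, S i, ∃ x, ∀ i, φ i x = s i) {u v w : Fin 3 → R}
    (h : ∀ i, VCut (W.map (φ i)) (φ i ∘ u) (φ i ∘ v) (φ i ∘ w)) : VCut W u v w := by
  choose A B p₁ p₂ q₁ q₂ t₁ t₂ c hc hAB hu hv hw hd using h
  obtain ⟨A', hA⟩ := exists_lift_vec hs A
  obtain ⟨B', hB⟩ := exists_lift_vec hs B
  obtain ⟨p₁', hp1⟩ := hs p₁
  obtain ⟨p₂', hp2⟩ := hs p₂
  obtain ⟨q₁', hq1⟩ := hs q₁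
  obtain ⟨q₂', hq2⟩ := hs q₂
  obtain ⟨t₁', ht1⟩ := hs t₁
  obtain ⟨t₂', ht2⟩ := hs t₂
  obtain ⟨c', hc'⟩ := hs c
  have hvec {u v : Fin 3 → R} (h : ∀ i, φ i ∘ u = φ i ∘ v) : u = v :=
    funext fun k => hi _ _ fun i => congrFun (h i) k
  refine ⟨A', B', p₁', p₂', q₁', q₂', t₁', t₂', c',
    isUnit_of_forall_map hi hs fun i => by rw [hc']; exact hc i,
    isPrimitive_of_forall_map hi hs fun i => by
      rw [← map_crossProduct, hA, hB]; exact hAB i,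
    hvec fun i => by rw [comp_smul_add_smul, hA, hB, hp1, hp2, hu],
    hvec fun i => by rw [comp_smul_add_smul, hA, hB, hq1, hq2, hv],
    hvec fun i => by rw [comp_smul_add_smul, hA, hB, ht1, ht2, hw], ?_, ?_, ?_, ?_⟩ <;>
  refine hi _ _ fun i => ?_
  · simp only [← cub_map, hA, (hd i).e0, map_mul, hp2, hq2, ht2, hc']
  · simp only [← pol_map, hA, hB, (hd i).e1, map_mul, map_add, map_neg, hp1, hq1, ht1, hp2, hq2,
      ht2, hc']
  · simp only [← pol_map, hA, hB, (hd i).e2, map_mul, map_add, hp1, hq1, ht1, hp2, hq2,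
      ht2, hc']
  · simp only [← cub_map, hB, (hd i).e3, map_mul, map_neg, hp1, hq1, ht1, hc']

theorem CutByLine.of_map (hi : ∀ x y, (∀ i, φ i x = φ i y) → x = y)
    (hs : ∀ s : ∀ i, S i, ∃ x, ∀ i, φ i x = s i) (hW : ∀ i, W.map (φ i) = W' i) {P Q T : Points W}
    (h : ∀ i, CutByLine (P.map (φ i) (hW i)) (Q.map (φ i) (hW i)) (T.map (φ i) (hW i))) :
    CutByLine P Q T := by
  obtain ⟨u, hu, -⟩ := P.exists_isRep
  obtain ⟨v, hv, -⟩ := Q.exists_isRep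
  obtain ⟨w, hw, -⟩ := T.exists_isRep
  rw [cutByLine_iff hu hv hw]
  refine VCut.of_map hi hs fun i => ?_
  have := (cutByLine_iff (hu.map _ (hW i)) (hv.map _ (hW i)) (hw.map _ (hW i))).1 (h i)
  rwa [← hW i] at this

/-- A family of additive maps to the points over the factors of a product of local rings assembles
to an additive map to the points over the product. -/
theorem exists_isAdditive_of_map [∀ i, IsLocalRing (S i)]
    (hi : ∀ x y, (∀ i, φ i x = φ i y) → x = y)
    (hs : ∀ s : ∀ i, S i, ∃ x, ∀ i, φ i x = s i) (hW : ∀ i, W.map (φ i) = W' i)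
    (hΔ : ∀ i, IsUnit (W' i).Δ) {G : ι → Type*} [∀ i, AddCommGroup (G i)]
    (ρ : ∀ i, G i → Points (W' i)) (hsurj : ∀ i, Function.Surjective (ρ i))
    (hcut : ∀ i a b, CutByLine (ρ i a) (ρ i b) (-ρ i (a + b))) (hadd : ∀ i, IsAdditive (ρ i)) :
    ∃ r : (∀ i, G i) → Points W, (∀ g i, (r g).map (φ i) (hW i) = ρ i (g i)) ∧
      IsAdditive r ∧ Function.Surjective r := by
  choose r hr using fun g : ∀ i, G i => Points.exists_of_map hi hs hW fun i => ρ i (g i)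
  refine ⟨r, hr, ⟨fun a b => ?_, ?_, fun a => ?_⟩, fun P => ?_⟩
  -- `R` itself need not be local; uniqueness of the sum is checked in each local factor.
  · refine (Points.add_eq_of_unique (CutByLine.of_map hi hs hW fun i => ?_) fun S' h' => ?_).symm
    · rw [Points.map_neg, hr, hr, hr]
      exact hcut i _ _
    · refine Points.ext_of_map hi hs hW fun i => ?_
      have := h'.map (φ i) (hW i)
      rw [hr, hr, Points.map_neg] at this
      rw [hr, ← Points.neg_neg (S'.map _ _), CutByLine.unique (hΔ i) this (hcut i _ _),
        Points.neg_neg]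
      rfl
  · exact Points.ext_of_map hi hs hW fun i => by
      rw [hr, Points.map_zero, Pi.zero_apply, (hadd i).zero]
  · exact Points.ext_of_map hi hs hW fun i => by
      rw [hr, Points.map_neg, Pi.neg_apply, (hadd i).neg, hr]
  · choose g hg using fun i => hsurj i (P.map (φ i) (hW i))
    exact ⟨g, Points.ext_of_map hi hs hW fun i => by rw [hr, hg]⟩

end Product

/-- The recursive multiple is computed upstairs in `G`, so associativity on `Points W` is never
needed. -/
theorem IsAdditive.mul_apply_eq {R : Type*} [CommRing R] {W : WeierstrassCurve R} {G : Type*}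
    [AddCommGroup G] {ρ : G → Points W} (h : IsAdditive ρ) (m : ℤ) (a : G) :
    mul m (ρ a) = ρ (m • a) := by
  have hn (n : ℕ) : nsmulRec n (ρ a) = ρ (n • a) := by
    induction n with
    | zero => rw [zero_nsmul, h.zero]; rfl
    | succ n ih => rw [succ_nsmul, h.add, ← ih]; rfl
  cases m with
  | ofNat n =>
    change nsmulRec n (ρ a) = _
    rw [hn, Int.ofNat_eq_natCast, natCast_zsmul]
  | negSucc n =>
    change -nsmulRec (n + 1) (ρ a) = _
    rw [hn, negSucc_zsmul, h.neg]

/-! ### The ring `ℤ / N` as a product of local rings -/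

section ZMod

variable {N : ℕ}

/-- The projection from `ℤ / N` to the factor at a prime divisor. -/
def toPrimePow (N : ℕ) (q : N.primeFactors) : ZMod N →+* ZMod ((q : ℕ) ^ N.factorization q) :=
  ZMod.castHom (Nat.ordProj_dvd N q) _

theorem equivPi_apply_eq (hN : N ≠ 0) (z : ZMod N) (q : N.primeFactors) :
    ZMod.equivPi N hN z q = toPrimePow N q z :=
  congrArg (fun f : ZMod N →+* _ => f z) (RingHom.ext_zmod
    ((Pi.evalRingHom (fun q : N.primeFactors => ZMod ((q : ℕ) ^ N.factorization q)) q).comp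
      (ZMod.equivPi N hN : ZMod N →+* _)) (toPrimePow N q))

theorem toPrimePow_injective (hN : N ≠ 0) (x y : ZMod N)
    (h : ∀ q, toPrimePow N q x = toPrimePow N q y) : x = y := by
  apply (ZMod.equivPi N hN).injective
  ext q
  rw [equivPi_apply_eq, equivPi_apply_eq, h]

theorem toPrimePow_surjective (hN : N ≠ 0)
    (s : ∀ q : N.primeFactors, ZMod ((q : ℕ) ^ N.factorization q)) :
    ∃ x, ∀ q, toPrimePow N q x = s q := by
  refine ⟨(ZMod.equivPi N hN).symm s, fun q => ?_⟩
  rw [← equivPi_apply_eq hN, RingEquiv.apply_symm_apply]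

end ZMod

/-! ### Prime coefficients of the `L`-series -/

section LSeries

open ArithmeticFunction in
-- Every factor is 1 at 1, and p factors only as 1 · p, so evaluation at p turns a finite product
-- into a sum, to which only the factor at p contributes.
theorem eulerProduct_ofPowerSeries_prime {A : Type*} [CommRing A] (f : Nat.Primes → PowerSeries A)
    (hf : ∀ i, (f i).constantCoeff = 1) (p : Nat.Primes) :
    eulerProduct (fun i : Nat.Primes => ofPowerSeries (i : ℕ) (f i)) p = (f p).coeff 1 := by
  classical
  have hlim := tendsTo_eulerProduct_of_tendsTo
    (fun i : Nat.Primes => ofPowerSeries (i : ℕ) (f i)) (fun n => ?_) p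
  · obtain ⟨s, hs⟩ := Filter.eventually_atTop.1 hlim
    have hs' := hs (insert p s) (Finset.subset_insert p s)
    rw [← hs']
    have h1 (s : Finset Nat.Primes) : (∏ i ∈ s, ofPowerSeries (i : ℕ) (f i)) 1 = 1 := by
      induction s using Finset.induction_on with
      | empty => simp
      | insert a s ha ih => rw [Finset.prod_insert ha]; simp [ih, hf]
    have hmul (g h : ArithmeticFunction A) : (g * h) (p : ℕ) = g 1 * h p + g p * h 1 := by
      rw [mul_apply, Nat.sum_divisorsAntidiagonal (fun x y => g x * h y), Nat.Prime.divisors p.2,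
        Finset.sum_pair p.2.one_lt.ne, Nat.div_one, Nat.div_self p.2.pos]
    have h2 (s : Finset Nat.Primes) : (∏ i ∈ s, ofPowerSeries (i : ℕ) (f i)) (p : ℕ) =
        ∑ i ∈ s, ofPowerSeries (i : ℕ) (f i) (p : ℕ) := by
      induction s using Finset.induction_on with
      | empty => simp [one_apply_ne p.2.ne_one]
      | insert a s ha ih =>
        rw [Finset.prod_insert ha, Finset.sum_insert ha, hmul, ih, h1]
        simp [hf, add_comm]
    rw [h2, Finset.sum_eq_single_of_mem p (Finset.mem_insert_self p s)]
    · have := ofPowerSeries_apply_pow p.2.one_lt (f p) 1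
      rwa [pow_one] at this
    · intro q _ hq
      rw [ofPowerSeries_apply q.2.one_lt, Function.extend_apply', Pi.zero_apply]
      rintro ⟨k, hk⟩
      have hk : (q : ℕ) ^ k = p := hk
      have hk0 : k ≠ 0 := by
        rintro rfl
        exact p.2.one_lt.ne (by simpa using hk)
      have hdvd : (q : ℕ) ∣ p := hk ▸ dvd_pow_self _ hk0
      exact hq (Subtype.ext ((Nat.prime_dvd_prime_iff_eq q.2 p.2).1 hdvd))
  -- Convergence: at each argument n, only factors at primes up to n can differ from those of the
  -- unit.
  · rcases n with _ | _ | n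
    · simp
    · simp [hf]
    · have hfin : {i : Nat.Primes | (i : ℕ) ≤ n + 2}.Finite :=
        Set.Finite.preimage (Subtype.val_injective.injOn) (Set.finite_Iic (n + 2))
      refine (hfin.subset fun i hi => ?_ : Set.Finite _)
      by_contra hin
      refine hi ?_
      have hin' : n + 2 < (i : ℕ) := not_le.1 hin
      change ofPowerSeries (i : ℕ) (f i) (n + 1 + 1) = _
      rw [ofPowerSeries_apply i.2.one_lt, Function.extend_apply', Pi.zero_apply,
        one_apply_ne (by omega)]
      rintro ⟨k, hk⟩
      have hk : (i : ℕ) ^ k = n + 1 + 1 := hk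
      have hk0 : k ≠ 0 := by
        rintro rfl
        rw [pow_zero] at hk
        omega
      have := Nat.le_of_dvd (by omega) (hk ▸ dvd_pow_self (i : ℕ) hk0)
      omega

theorem coeff_one_invOfUnit_quadratic {A : Type*} [CommRing A] (a b : A) :
    (PowerSeries.invOfUnit
      (1 - PowerSeries.C a * PowerSeries.X + PowerSeries.C b * PowerSeries.X ^ 2) 1).coeff 1 = a := by
  have hmul := PowerSeries.mul_invOfUnit
    (1 - PowerSeries.C a * PowerSeries.X + PowerSeries.C b * PowerSeries.X ^ 2) 1 (by simp)
  have h1 := congrArg (PowerSeries.coeff 1) hmul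
  rw [PowerSeries.coeff_mul, Finset.Nat.antidiagonal_succ] at h1
  simp [PowerSeries.coeff_one, PowerSeries.coeff_X_pow, PowerSeries.constantCoeff_invOfUnit] at h1
  linear_combination h1

theorem lCoeff_prime (E : WeierstrassCurve ℚ) {p : ℕ} (hp : p.Prime) :
    lCoeff E p = traceAt E p := by
  classical
  have h := eulerProduct_ofPowerSeries_prime (fun p : Nat.Primes =>
      (PowerSeries.invOfUnit
        (1 - PowerSeries.C (traceAt E p) * PowerSeries.X +
          PowerSeries.C (if GoodReduction E p then (p : ℤ) else 0) * PowerSeries.X ^ 2) 1))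
    (fun i => by simp [PowerSeries.constantCoeff_invOfUnit]) ⟨p, hp⟩
  rw [lCoeff]
  convert! h using 1
  exact (coeff_one_invOfUnit_quadratic _ _).symm

end LSeries

/-! ### Finite abelian groups with few elements of order two -/

section FiniteGroup

variable {H : Type*} [AddCommGroup H]

theorem card_ker_mul_card_range (f : H →+ H) : Nat.card f.ker * Nat.card f.range = Nat.card H := by
  rw [← AddSubgroup.index_ker, AddSubgroup.card_mul_index]

/-- The sum of two distinct elements of order 2 is a third one. -/
theorem ncard_addOrderOf_two_ne_two : {y : H | addOrderOf y = 2}.ncard ≠ 2 := by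
  intro h2
  have hp : Fact (Nat.Prime 2) := ⟨Nat.prime_two⟩
  obtain ⟨a, b, hab, hs⟩ := Set.ncard_eq_two.1 h2
  have ha : a ∈ {y : H | addOrderOf y = 2} := hs ▸ Set.mem_insert _ _
  have hb : b ∈ {y : H | addOrderOf y = 2} := hs ▸ Set.mem_insert_of_mem _ rfl
  rw [Set.mem_ofPred_eq, addOrderOf_eq_prime_iff] at ha hb
  have hc : a + b ∈ {y : H | addOrderOf y = 2} := by
    rw [Set.mem_ofPred_eq, addOrderOf_eq_prime_iff]
    refine ⟨by rw [nsmul_add, ha.1, hb.1, add_zero], fun h => hab ?_⟩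
    rw [eq_neg_of_add_eq_zero_left h, neg_eq_iff_add_eq_zero, ← two_nsmul, hb.1]
  rw [hs] at hc
  rcases hc with h | h
  · exact hb.2 (by simpa using h)
  · exact ha.2 (by simpa using h)

variable [Finite H]

theorem card_ker_comp_le (f g : H →+ H) :
    Nat.card (f.comp g).ker ≤ Nat.card f.ker * Nat.card g.ker := by
  have hle : g.ker ≤ (f.comp g).ker := fun x hx => by
    rw [AddMonoidHom.mem_ker] at hx ⊢
    rw [AddMonoidHom.comp_apply, hx, map_zero]
  have h := AddSubgroup.relIndex_mul_relIndex ⊥ g.ker (f.comp g).ker bot_le hle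
  rw [AddSubgroup.relIndex_bot_left, AddSubgroup.relIndex_bot_left, AddSubgroup.relIndex_ker] at h
  rw [← h, mul_comm]
  refine Nat.mul_le_mul_right _ (AddSubgroup.card_le_of_le ?_)
  rintro _ ⟨x, hx, rfl⟩
  exact hx

theorem card_ker_two_pow_le (h : Nat.card (nsmulAddMonoidHom (α := H) 2).ker ≤ 2) (j : ℕ) :
    Nat.card (nsmulAddMonoidHom (α := H) (2 ^ j)).ker ≤ 2 ^ j := by
  induction j with
  | zero =>
    have : (nsmulAddMonoidHom (α := H) (2 ^ 0)).ker = ⊥ := by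
      ext x
      simp
    rw [this, AddSubgroup.card_bot, pow_zero]
  | succ j ih =>
    have : nsmulAddMonoidHom (α := H) (2 ^ (j + 1)) =
        (nsmulAddMonoidHom 2).comp (nsmulAddMonoidHom (2 ^ j)) := by
      ext x
      simp [pow_succ, mul_nsmul]
    rw [this, pow_succ, mul_comm]
    exact (card_ker_comp_le _ _).trans (Nat.mul_le_mul h ih)

theorem card_ker_two : Nat.card (nsmulAddMonoidHom (α := H) 2).ker =
    {y : H | addOrderOf y = 2}.ncard + 1 := by
  have hp : Fact (Nat.Prime 2) := ⟨Nat.prime_two⟩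
  have : ((nsmulAddMonoidHom (α := H) 2).ker : Set H) = insert 0 {y : H | addOrderOf y = 2} := by
    ext y
    simp only [SetLike.mem_coe, AddMonoidHom.mem_ker, nsmulAddMonoidHom_apply, Set.mem_insert_iff,
      Set.mem_ofPred_eq, addOrderOf_eq_prime_iff]
    by_cases hy : y = 0 <;> simp [hy]
  rw [← Set.ncard_insert_of_notMem (a := 0) (by simp) (Set.toFinite _), ← this]
  rfl

/-- The 2-torsion has order 4, so 2H has order r = #H/4, and M/2 is a multiple of 2r, which kills H.
-/
theorem smul_half_eq_zero (h3 : {y : H | addOrderOf y = 2}.ncard = 3) {M : ℤ}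
    (hM : (Nat.card H : ℤ) ∣ M) (y : H) : (M / 2) • y = 0 := by
  have hcard := card_ker_mul_card_range (nsmulAddMonoidHom (α := H) 2)
  rw [card_ker_two, h3] at hcard
  obtain ⟨c, rfl⟩ := hM
  set r := Nat.card (nsmulAddMonoidHom (α := H) 2).range
  have hr : r • (2 • y) = 0 := by
    have := card_nsmul_eq_zero' (x := (⟨2 • y, y, rfl⟩ : (nsmulAddMonoidHom (α := H) 2).range))
    exact congrArg Subtype.val this
  have e : (Nat.card H : ℤ) * c / 2 = c * ((r : ℤ) * 2) := by
    rw [← hcard]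
    refine Int.ediv_eq_of_eq_mul_left two_ne_zero ?_
    push_cast
    ring
  rw [e, mul_smul, mul_smul, natCast_zsmul, ofNat_zsmul, hr, smul_zero]

/-- Write n = 2^a o with o odd. Since #H ∣ 2n, failure of #H ∣ n means 2^(a+1) ∣ #H. But 2^a H is
killed by o, hence has odd order, so 2^(a+1) divides #H[2^a], which is at most 2^a because #H[2] ≤
2. -/
theorem card_dvd_of_smul_eq_zero (h1 : {y : H | addOrderOf y = 2}.ncard ≤ 1) {n : ℕ}
    (hn : Nat.card H ∣ 2 * n) (hk : ∀ y : H, n • y = 0) : Nat.card H ∣ n := by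
  rcases eq_or_ne n 0 with rfl | hn0
  · exact dvd_zero _
  obtain ⟨a, o, ho, rfl⟩ := Nat.exists_eq_two_pow_mul_odd hn0
  by_contra hnd
  have hm0 : Nat.card H ≠ 0 := Nat.card_pos.ne'
  obtain ⟨b, o', ho', hm⟩ := Nat.exists_eq_two_pow_mul_odd hm0
  have hoo : o' ∣ o := by
    have h : o' ∣ 2 ^ (a + 1) * o := by
      refine (Dvd.intro_left (2 ^ b) hm.symm).trans (hn.trans (dvd_of_eq ?_))
      ring
    exact (Nat.Coprime.pow_right _ (Nat.coprime_two_right.2 ho')).dvd_of_dvd_mul_left h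
  have hab : a + 1 ≤ b := by
    by_contra hab
    refine hnd (hm ▸ mul_dvd_mul (pow_dvd_pow 2 (by omega)) hoo)
  have hcard := card_ker_mul_card_range (nsmulAddMonoidHom (α := H) (2 ^ a))
  have hle := card_ker_two_pow_le (H := H) (by rw [card_ker_two]; omega) a
  have hodd : ¬ 2 ∣ Nat.card (nsmulAddMonoidHom (α := H) (2 ^ a)).range := by
    intro h
    have hp : Fact (Nat.Prime 2) := ⟨Nat.prime_two⟩
    obtain ⟨⟨_, y, rfl⟩, hy⟩ := exists_prime_addOrderOf_dvd_card' 2 h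
    rw [addOrderOf_eq_prime_iff] at hy
    refine hy.2 ?_
    have h2 : 2 • (2 ^ a • y) = 0 := congrArg Subtype.val hy.1
    have h3 : o • (2 ^ a • y) = 0 := by
      rw [← mul_nsmul]
      exact hk y
    obtain ⟨c, rfl⟩ := ho
    refine Subtype.ext ?_
    change 2 ^ a • y = 0
    rwa [add_nsmul, one_nsmul, mul_nsmul, h2, smul_zero, zero_add] at h3
  have hdvd : 2 ^ (a + 1) ∣ Nat.card (nsmulAddMonoidHom (α := H) (2 ^ a)).ker := by
    have h : 2 ^ (a + 1) ∣ Nat.card (nsmulAddMonoidHom (α := H) (2 ^ a)).ker *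
        Nat.card (nsmulAddMonoidHom (α := H) (2 ^ a)).range := by
      rw [hcard, hm]
      exact (pow_dvd_pow 2 hab).mul_right o'
    exact (Nat.Coprime.pow_left _ ((Nat.Prime.coprime_iff_not_dvd Nat.prime_two).2
      hodd)).dvd_of_dvd_mul_right h
  have := Nat.le_of_dvd Nat.card_pos hdvd
  rw [pow_succ] at this
  have h2 : 0 < 2 ^ a := by positivity
  omega

end FiniteGroup

/-! ### The reduction of a minimal model -/

section Reduction

variable {E : WeierstrassCurve ℚ} {p : ℕ} [Fact p.Prime]

theorem modCurve_map {m n : ℕ} (f : ZMod m →+* ZMod n) : (modCurve E m).map f = modCurve E n := by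
  rw [modCurve, WeierstrassCurve.map_map, modCurve]
  exact congrArg _ (Subsingleton.elim _ _)

theorem Δ_modCurve_ne_zero (h : GoodReduction E p) : (modCurve E p).Δ ≠ 0 := by
  rw [modCurve, WeierstrassCurve.map_Δ, eq_intCast, Ne, ZMod.intCast_zmod_eq_zero_iff_dvd]
  exact h

theorem isUnit_Δ_map_padicInt (h : GoodReduction E p) :
    IsUnit ((minimalModel E).map (Int.castRingHom ℤ_[p])).Δ := by
  refine isUnit_of_isUnit_map (f := PadicInt.toZMod) (ZMod.ringHom_surjective _) ?_
  rw [WeierstrassCurve.map_Δ, eq_intCast, map_intCast, isUnit_iff_ne_zero, Ne,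
    ZMod.intCast_zmod_eq_zero_iff_dvd]
  exact h

theorem card_point_modCurve (h : GoodReduction E p) :
    (Nat.card (modCurve E p).toAffine.Point : ℤ) = p + 1 - lCoeff E p := by
  rw [lCoeff_prime E Fact.out, traceAt, card_affPoint (Δ_modCurve_ne_zero h)]
  ring

theorem card_ker_castHom_prime_pow (e : ℕ) (h : p ∣ p ^ (e + 1)) :
    Nat.card (RingHom.ker (ZMod.castHom h (ZMod p))) = p ^ e := by
  have hp : p.Prime := Fact.out
  have h1 := AddSubgroup.card_mul_index (ZMod.castHom h (ZMod p)).toAddMonoidHom.ker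
  rw [AddSubgroup.index_ker, AddMonoidHom.range_eq_top_of_surjective _
    (ZMod.ringHom_surjective (ZMod.castHom h (ZMod p))), AddSubgroup.card_top, Nat.card_zmod,
    Nat.card_zmod] at h1
  exact Nat.eq_of_mul_eq_mul_right hp.pos (h1.trans (pow_succ p e))

/-- The group of points over `ℚ_p` with its reductions modulo `p ^ e` and modulo `p`. -/
theorem exists_reduction (h : GoodReduction E p) {e : ℕ} (he : e ≠ 0) :
    ∃ (G : Type) (_ : AddCommGroup G) (ρ : G → Points (modCurve E (p ^ e))) (hρ : IsAdditive ρ)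
      (π : G →+ (modCurve E p).toAffine.Point),
      Function.Surjective ρ ∧ (∀ a b, CutByLine (ρ a) (ρ b) (-ρ (a + b))) ∧
      Function.Surjective π ∧ hρ.ker ≤ π.ker ∧ hρ.ker.relIndex π.ker = p ^ (e - 1) := by
  classical
  obtain ⟨e, rfl⟩ := Nat.exists_eq_succ_of_ne_zero he
  have hp : p.Prime := Fact.out
  have _ : Fact (1 < p ^ (e + 1)) := ⟨Nat.one_lt_pow he hp.one_lt⟩
  have hΔ := isUnit_Δ_map_padicInt h
  have hΔ' := Δ_modCurve_ne_zero h
  let f : ℤ_[p] →+* ZMod (p ^ (e + 1)) := PadicInt.toZModPow (e + 1)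
  have hf : Function.Surjective f := ZMod.ringHom_surjective f
  let g : ZMod (p ^ (e + 1)) →+* ZMod p := ZMod.castHom (dvd_pow_self p he) (ZMod p)
  have hg : Function.Surjective g := ZMod.ringHom_surjective g
  have hW : ((minimalModel E).map (Int.castRingHom ℤ_[p])).map f = modCurve E (p ^ (e + 1)) := by
    rw [WeierstrassCurve.map_map, modCurve]
    exact congrArg _ (Subsingleton.elim _ _)
  have hW' : ((minimalModel E).map (Int.castRingHom ℤ_[p])).map (g.comp f) = modCurve E p := by
    rw [WeierstrassCurve.map_map, modCurve]
    exact congrArg _ (Subsingleton.elim _ _)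
  have hρ := isAdditive_reduce hW hf hΔ
  have hρ' := isAdditive_reduce hW' (hg.comp hf) hΔ
  obtain ⟨hle, hidx⟩ := relIndex_ker_reduce hf hg hΔ hW hW'
  -- Since `affPoint` is bijective, `s` is its inverse; composing with it turns reduction modulo p
  -- into a homomorphism of genuine groups.
  choose s hs using affPoint_surjective hΔ'
  let π : _ →+ (modCurve E p).toAffine.Point := AddMonoidHom.mk' (fun P => s (reduce hW' P))
    fun P Q => affPoint_injective (by rw [affPoint_add hΔ', hs, hs, hs, hρ'.add])
  have hπ : π.ker = hρ'.ker := by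
    ext P
    rw [AddMonoidHom.mem_ker, hρ'.mem_ker]
    change s (reduce hW' P) = 0 ↔ _
    rw [← affPoint_injective.eq_iff, hs]
    rfl
  refine ⟨_, inferInstance, reduce hW, hρ, π, reduce_surjective hW hf hΔ, cutByLine_reduce hW,
    fun Q => ?_, hπ ▸ hle, ?_⟩
  · obtain ⟨P, hP⟩ := reduce_surjective hW' (hg.comp hf) hΔ (affPoint Q)
    refine ⟨P, affPoint_injective ?_⟩
    change affPoint (s (reduce hW' P)) = _
    rw [hs, hP]
  · rw [hπ, hidx, Nat.succ_sub_one]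
    exact card_ker_castHom_prime_pow e _

end Reduction

/-! ### Multiples annihilating a quotient -/

section Group

variable {G H : Type*} [AddCommGroup G] [AddCommGroup H] {K : AddSubgroup G} {π : G →+ H}

theorem smul_mem_of_card_dvd (hπ : Function.Surjective π) (hK : K ≤ π.ker) {m : ℕ}
    (hm : K.relIndex π.ker = m) {M : ℤ} (hM : ((m * Nat.card H : ℕ) : ℤ) ∣ M) (x : G) :
    M • x ∈ K := by
  have hidx : K.index = m * Nat.card H := by
    rw [← AddSubgroup.relIndex_mul_index hK, hm, AddSubgroup.index_ker,
      AddMonoidHom.range_eq_top_of_surjective _ hπ, AddSubgroup.card_top]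
  obtain ⟨c, rfl⟩ := hM
  rw [mul_comm, mul_smul, natCast_zsmul, ← hidx]
  exact K.zsmul_mem (K.nsmul_index_mem x) c

/-- The quotient of the kernel of `π` by `K` has odd order, hence no 2-torsion. -/
theorem mem_of_two_smul_mem {m : ℕ} (hm : K.relIndex π.ker = m) (hm2 : Odd m)
    {x : G} (hx : π x = 0) (h : x + x ∈ K) : x ∈ K := by
  have h1 : m • x ∈ K := by
    have := (K.addSubgroupOf π.ker).nsmul_index_mem (⟨x, hx⟩ : π.ker)
    rw [← hm]
    exact this
  obtain ⟨c, rfl⟩ := hm2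
  have h2 : x = (2 * c + 1) • x - c • (x + x) := by
    rw [add_nsmul, one_nsmul, mul_nsmul, two_nsmul, nsmul_add]
    abel
  rw [h2]
  exact K.sub_mem h1 (K.nsmul_mem h c)

end Group

/-! ### The Korselt conditions and the Euler criterion -/

theorem smul_half_eq_zero_iff {H : Type*} [AddCommGroup H] [Finite H]
    (h3 : {y : H | addOrderOf y = 2}.ncard ≤ 3) {M : ℤ} (hM : Even M) (hd : (Nat.card H : ℤ) ∣ M) :
    (∀ y : H, (M / 2) • y = 0) ↔
      (Nat.card H : ℤ) ∣ M / 2 ∨ {y : H | addOrderOf y = 2}.ncard = 3 := by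
  refine ⟨fun h => or_iff_not_imp_right.2 fun hne => ?_, ?_⟩
  · obtain ⟨k, rfl⟩ := hM
    rw [show (k + k) / 2 = k by omega] at h ⊢
    have h2 := ncard_addOrderOf_two_ne_two (H := H)
    rw [Int.natCast_dvd]
    refine card_dvd_of_smul_eq_zero (by omega) ?_ fun y => ?_
    · rw [Int.natCast_dvd] at hd
      convert! hd using 1
      omega
    · rcases Int.natAbs_eq k with hk | hk
      · rw [← natCast_zsmul, ← hk, h]
      · rw [← natCast_zsmul, ← neg_eq_zero, ← neg_zsmul, ← hk, h]
  · rintro (⟨c, hc⟩ | h) y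
    · rw [hc, mul_comm, mul_smul, natCast_zsmul, card_nsmul_eq_zero', smul_zero]
    · exact smul_half_eq_zero h hd y

theorem prime_pow_mul_card_dvd {E : WeierstrassCurve ℚ} {N p : ℕ} [Fact p.Prime] (hodd : Odd N)
    (hN : IsKorseltTypeI E N) (hpN : p ∣ N) :
    ((p ^ (N.factorization p - 1) * Nat.card (modCurve E p).toAffine.Point : ℕ) : ℤ) ∣
      (N : ℤ) + 1 - lCoeff E N := by
  have hp : p.Prime := Fact.out
  have hN0 : N ≠ 0 := hodd.pos.ne'
  have hp2 : p ≠ 2 := by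
    rintro rfl
    exact Nat.not_even_iff_odd.2 hodd (even_iff_two_dvd.2 hpN)
  have hp3 : 3 ≤ p := by have := hp.two_le; omega
  obtain ⟨hg, hd, hm⟩ := hN.2 p hp hpN
  have hcard := card_point_modCurve hg
  rw [← hcard] at hd
  have hle := card_affine_point_le (W := modCurve E p)
  have _ : Finite (modCurve E p).toAffine.Point := affine_point_finite
  have hpos : 0 < Nat.card (modCurve E p).toAffine.Point := Nat.card_pos
  set h := Nat.card (modCurve E p).toAffine.Point
  have he : 0 < N.factorization p := hp.factorization_pos_of_dvd hN0 hpN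
  have hdN : (p : ℤ) ^ N.factorization p ∣ (N : ℤ) := by exact_mod_cast Nat.ordProj_dvd N p
  obtain ⟨e, hee⟩ := Nat.exists_eq_succ_of_ne_zero he.ne'
  rw [hee, Nat.succ_eq_add_one] at hdN
  have hm := (pow_dvd_iff_le_emultiplicity.1 hdN).trans hm
  rw [hee, Nat.succ_sub_one, Nat.cast_mul, Nat.cast_pow]
  -- With exponent e + 1 of p in N: if a_p ≡ 1 then #E(𝔽_p) = p m with 0 < m < p, and p^(e+1) and m
  -- are coprime divisors of M. Otherwise p^e and #E(𝔽_p) are coprime divisors of M.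
  split_ifs at hm with hap
  · rw [add_zero] at hm
    have h1 := pow_dvd_of_le_emultiplicity hm
    have hM : (p : ℤ) ^ (e + 1) ∣ (N : ℤ) + 1 - lCoeff E N := by
      rw [add_sub_assoc, ← neg_sub (lCoeff E N)]
      exact dvd_add hdN h1.neg_right
    have hph : p ∣ h := by
      have h2 := hap.symm.dvd
      rw [← Int.natCast_dvd_natCast, hcard, add_sub_assoc, ← neg_sub (lCoeff E p)]
      exact dvd_add dvd_rfl h2.neg_right
    obtain ⟨m, hm'⟩ := hph
    have hmp : m < p := by
      by_contra hmp
      have : p * p ≤ h := hm' ▸ Nat.mul_le_mul_left p (not_lt.1 hmp)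
      nlinarith
    have hm0 : 0 < m := Nat.pos_of_ne_zero (by rintro rfl; omega)
    have hcop : IsCoprime ((p : ℤ) ^ (e + 1)) m :=
      (Nat.isCoprime_iff_coprime.2 (Nat.coprime_of_lt_prime hm0.ne' hmp hp)).pow_left
    have hmd : (m : ℤ) ∣ (N : ℤ) + 1 - lCoeff E N :=
      (Int.natCast_dvd_natCast.2 (hm' ▸ dvd_mul_left m p)).trans hd
    rw [hm', Nat.cast_mul, ← mul_assoc, ← pow_succ]
    exact hcop.mul_dvd hM hmd
  · have hm : ((e : ℕ) : ℕ∞) ≤ emultiplicity (p : ℤ) (lCoeff E N - 1) := by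
      rw [Nat.cast_add, Nat.cast_one] at hm
      exact (ENat.add_le_add_iff_right ENat.one_ne_top).1 hm
    have h1 := pow_dvd_of_le_emultiplicity hm
    have hM : (p : ℤ) ^ e ∣ (N : ℤ) + 1 - lCoeff E N := by
      rw [add_sub_assoc, ← neg_sub (lCoeff E N)]
      exact dvd_add ((pow_dvd_pow _ e.le_succ).trans hdN) h1.neg_right
    have hph : ¬ p ∣ h := by
      rw [← Int.natCast_dvd_natCast, hcard, add_sub_assoc, dvd_add_right dvd_rfl]
      exact fun h => hap (Int.modEq_iff_dvd.2 h)
    exact (Nat.isCoprime_iff_coprime.2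
      ((Nat.Prime.coprime_iff_not_dvd hp).2 hph)).pow_left.mul_dvd hM hd

/-- The Korselt conditions already make M kill everything, so the condition on doubles is automatic.
The alternative [x : y : 1] gives no freedom on points supported at one prime, and the odd order of
the reduction kernels allows passage to 𝔽_p. -/
theorem isEulerCarmichael_iff_smul_eq_zero {E : WeierstrassCurve ℚ} {N : ℕ} (hodd : Odd N)
    (hN : IsKorseltTypeI E N) (heven : Even ((N : ℤ) + 1 - lCoeff E N)) :
    IsEulerCarmichael E N ↔ ∀ (p : ℕ) [Fact p.Prime], p ∣ N →
      ∀ y : (modCurve E p).toAffine.Point, (((N : ℤ) + 1 - lCoeff E N) / 2) • y = 0 := by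
  have hN0 : N ≠ 0 := hodd.pos.ne'
  have hprime (q : N.primeFactors) : Fact (q : ℕ).Prime := ⟨Nat.prime_of_mem_primeFactors q.2⟩
  have hdvd (q : N.primeFactors) : (q : ℕ) ∣ N := Nat.dvd_of_mem_primeFactors q.2
  have hgood (q : N.primeFactors) : GoodReduction E q := (hN.2 q (hprime q).out (hdvd q)).1
  have he (q : N.primeFactors) : N.factorization q ≠ 0 :=
    ((hprime q).out.factorization_pos_of_dvd hN0 (hdvd q)).ne'
  choose G instG ρ hρ π hsurj hcut hπ hK hidx using
    fun q : N.primeFactors => exists_reduction (hgood q) (he q)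
  have hnt (q : N.primeFactors) : Nontrivial (ZMod ((q : ℕ) ^ N.factorization q)) :=
    ZMod.nontrivial_iff.2 (Nat.one_lt_pow (he q) (hprime q).out.one_lt).ne'
  have hloc (q : N.primeFactors) : IsLocalRing (ZMod ((q : ℕ) ^ N.factorization q)) :=
    IsLocalRing.of_surjective' (PadicInt.toZModPow (p := q) _) (ZMod.ringHom_surjective _)
  have hW (q : N.primeFactors) : (modCurve E N).map (toPrimePow N q) =
      modCurve E ((q : ℕ) ^ N.factorization q) := modCurve_map _
  have hΔ (q : N.primeFactors) : IsUnit (modCurve E ((q : ℕ) ^ N.factorization q)).Δ := by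
    rw [← modCurve_map (ZMod.castHom (dvd_refl _) _)]
    have h := (isUnit_Δ_map_padicInt (hgood q)).map (PadicInt.toZModPow (N.factorization q))
    rw [← WeierstrassCurve.map_Δ, WeierstrassCurve.map_map] at h
    convert! h using 2
    rw [modCurve, WeierstrassCurve.map_map]
    exact congrArg _ (Subsingleton.elim _ _)
  obtain ⟨r, hr, hadd, hrs⟩ := exists_isAdditive_of_map (toPrimePow_injective hN0)
    (toPrimePow_surjective hN0) hW hΔ ρ hsurj hcut hρ
  have hext {P Q : Points (modCurve E N)}
      (h : ∀ q, P.map (toPrimePow N q) (hW q) = Q.map (toPrimePow N q) (hW q)) : P = Q :=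
    Points.ext_of_map (toPrimePow_injective hN0) (toPrimePow_surjective hN0) hW h
  have hMx (q : N.primeFactors) (x : G q) : ((N : ℤ) + 1 - lCoeff E N) • x ∈ (hρ q).ker :=
    smul_mem_of_card_dvd (hπ q) (hK q) (hidx q) (prime_pow_mul_card_dvd hodd hN (hdvd q)) x
  obtain ⟨k, hk⟩ := heven
  have hM2 : ((N : ℤ) + 1 - lCoeff E N) / 2 = k := by omega
  rw [hk] at hMx
  have hzero {a : ∀ q, G q} (h : ∀ q, k • a q ∈ (hρ q).ker) : mul k (r a) = 0 := by
    rw [hadd.mul_apply_eq]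
    refine hext fun q => ?_
    rw [hr, Points.map_zero]
    exact h q
  constructor
  · intro hC p hpf hpN y
    classical
    rw [hM2]
    let q₀ : N.primeFactors := ⟨p, Nat.mem_primeFactors.2 ⟨hpf.out, hpN, hN0⟩⟩
    obtain ⟨x, rfl⟩ := hπ q₀ y
    rw [← map_zsmul]
    refine hK q₀ ?_
    have htor : IsTwoTorsion (mul k (r (Pi.single q₀ x))) := by
      obtain ⟨-, -, -, h1, h2⟩ := hC (r (Pi.single q₀ x))
      rw [hM2] at h1 h2
      by_cases hQ : ∃ Q, r (Pi.single q₀ x) = Q + Q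
      · exact Or.inl (h1 hQ)
      · exact h2 hQ
    rw [hadd.mul_apply_eq] at htor
    rcases htor with h0 | ⟨a, b, hab, -⟩
    · have h1 := hr (k • Pi.single q₀ x) q₀
      rw [h0, Points.map_zero, Pi.smul_apply, Pi.single_eq_same] at h1
      exact h1.symm
    -- At a second prime divisor the multiple reduces to [0 : 1 : 0], which is incompatible with
    -- last coordinate 1.
    · obtain ⟨q₁, hq₁, hne⟩ := Finset.exists_mem_ne (lt_of_lt_of_le one_lt_two hN.1) p
      have h1 := hr (k • Pi.single q₀ x) ⟨q₁, hq₁⟩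
      have hne' : (⟨q₁, hq₁⟩ : N.primeFactors) ≠ q₀ := fun h => hne (congrArg Subtype.val h)
      rw [Pi.smul_apply, Pi.single_eq_of_ne hne', smul_zero, (hρ _).zero] at h1
      have h2 := hab.map _ (hW ⟨q₁, hq₁⟩)
      rw [h1, Points.isRep_iff Points.isRep_zero] at h2
      obtain ⟨c, -, hc⟩ := h2
      have h3 := congrFun hc 2
      have _ := hnt ⟨q₁, hq₁⟩
      simp at h3
  · intro h P
    simp only [hM2] at h
    rw [IsEulerPseudoprime, hM2]
    refine ⟨⟨k, hk⟩, hN.1, fun p hp hpN => (hN.2 p hp hpN).1, ?_, fun _ => Or.inl ?_⟩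
    · rintro ⟨Q, rfl⟩
      obtain ⟨b, rfl⟩ := hrs Q
      rw [← hadd.add]
      refine hzero fun q => ?_
      rw [Pi.add_apply, smul_add, ← add_smul]
      exact hMx q (b q)
    · obtain ⟨a, rfl⟩ := hrs P
      refine hzero fun q => ?_
      have hqodd : Odd (q : ℕ) := hodd.of_dvd_nat (hdvd q)
      -- The element k • a q dies in E(𝔽_q), and its double M • a q dies modulo the full prime
      -- power.
      refine mem_of_two_smul_mem (hidx q) hqodd.pow ?_ ?_
      · rw [map_zsmul]
        exact h q (hdvd q) _
      · rw [← add_smul]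
        exact hMx q (a q)

end EllipticKorselt

theorem mainTheorem4 (E : WeierstrassCurve ℚ) [E.IsElliptic] (N : ℕ) (hodd : Odd N)
    (hN : EllipticKorselt.IsKorseltTypeI E N)
    (heven : Even ((N : ℤ) + 1 - EllipticKorselt.lCoeff E N)) :
    EllipticKorselt.IsEulerCarmichael E N ↔
      ∀ (p : ℕ) [Fact p.Prime], p ∣ N →
        ((p : ℤ) + 1 - EllipticKorselt.lCoeff E p ∣ ((N : ℤ) + 1 - EllipticKorselt.lCoeff E N) / 2 ∨
          {P : (EllipticKorselt.modCurve E p).toAffine.Point | addOrderOf P = 2}.ncard = 3) := by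
  rw [EllipticKorselt.isEulerCarmichael_iff_smul_eq_zero hodd hN heven]
  refine forall_congr' fun p => forall_congr' fun hp => forall_congr' fun hpN => ?_
  obtain ⟨hg, hd, -⟩ := hN.2 p hp.out hpN
  have _ : Finite (EllipticKorselt.modCurve E p).toAffine.Point :=
    EllipticKorselt.affine_point_finite
  have hp2 : p ≠ 2 := by
    rintro rfl
    exact Nat.not_even_iff_odd.2 hodd (even_iff_two_dvd.2 hpN)
  rw [← EllipticKorselt.card_point_modCurve hg] at hd ⊢
  exact EllipticKorselt.smul_half_eq_zero_iff (EllipticKorselt.ncard_addOrderOf_two_le hp2) heven hd
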